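/- **Setting.** All quantum systems have separable (finite- or infinite-dimensional) Hilbert spaces. Let $\mathscr A,\mathscr B,\mathscr C$ be finite index sets with $|\mathscr A|+|\mathscr B|+|\mathscr C|\ge 2$. A *multiplex channel* $\mathcal N_{\vec{A'}\vec B\to\vec A\vec C}$ is a quantum channel (completely positive trace-preserving map on trace-class operators) with inputs $\{A'_a\}_{a\in\mathscr A},\{B_b\}_{b\in\mathscr B}$ and outputs $\{A_a\}_{a\in\mathscr A},\{C_c\}_{c\in\mathscr C}$; it is used by $|\mathscr A|+|\mathscr B|+|\mathscr C|$ parties, of which party $a\in\mathscr A$ inputs $A'_a$ and receives $A_a$, party $b\in\mathscr B$ inputs $B_b$ and party $c\in\mathscr C$ receives $C_c$. For a family of systems held by separate parties, $\mathrm{FS}$ denotes the set of fully separable states, i.e. states of the form $\sum_j w_j\bigotimes_p|\psi^j_p\rangle\langle\psi^j_p|$ with $w$ a probability distribution on a countable set and $\psi^j_p$ unit vectors of the system of party $p$. Let $D_{\max}(\rho\Vert\sigma)=\inf\{\lambda\in\mathbb R:\rho\le 2^\lambda\sigma\}$ ($=+\infty$ if there is no such $\lambda$), and $$E_{\max,E}(\mathcal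 N)=\sup_{\psi\in \mathrm{FS}(:\vec{LA'}:\vec{RB}:)}\ \inf_{\sigma\in \mathrm{FS}(:\vec{LA}:\vec R:\vec C:)}D_{\max}(\mathcal N(\psi)\Vert\sigma)\in[-\infty,+\infty],$$ where the supremum is also over all reference systems $L_a$ $(a\in\mathscr A)$ and $R_b$ $(b\in\mathscr B)$, kept by the respective parties. An *LOCC channel* here is a channel of the form $\sum_{x}\bigotimes_p\mathcal E^{p,x}$, with $x$ in a countable set and each $\mathcal E^{p,x}$ a completely positive trace non-increasing map from the system of party $p$ before to that of party $p$ after the channel. A *private state* with $K$-dimensional key systems $K_p$ and shield systems $S_p$, one pair for each party $p$, is a state $U(\Phi^{\rm GHZ}\otimes\omega)U^\dagger$, where $\Phi^{\rm GHZ}$ is the projection onto $K^{-1/2}\sum_{c=1}^K\bigotimes_p|c\rangle_{K_p}$, $\omega$ is any state of the shield systems, and $U=\sum_{\vec k}|\vec k\rangle\langle\vec k|\otimes V^{\vec k}$ with arbitrary unitaries $V^{\vec k}$ on the shield systems, $\vec k$ running through the tuples of key values. For $n\ge1$, an *$(n,K,\varepsilon)$ LOCC-assisted secret-key-agreement protocol*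 over $\mathcal N$ consists of a fully separable state of all the parties (each holding its channel input, if any, and a reference system), $n$ uses of $\mathcal N$, an LOCC channel among all the parties between any two consecutive uses, and a final LOCC channel, such that the resulting state $\omega$ of key and shield systems satisfies $F(\gamma,\omega)\ge1-\varepsilon$ for some private state $\gamma$; here $F(\rho,\sigma)=\big(\operatorname{Tr}\sqrt{\sqrt\sigma\rho\sqrt\sigma}\big)^2$. A real $R$ is a *strong converse rate* if for all $\varepsilon\in[0,1)$, $\delta>0$ and all sufficiently large $n$ there is no $(n,K,\varepsilon)$ protocol with $K\ge2^{n(R+\delta)}$; the *strong converse capacity* $\widetilde P_{\rm LOCC}(\mathcal N)$ is the infimum of all strong converse rates. **Theorem.** Let $\mathcal N$ be a multiplex channel. 1. For all integers $n,K\ge1$ and all $\varepsilon\in(0,1)$, if there is an $(n,K,\varepsilon)$ LOCC-assisted secret-key-agreement protocol over $\mathcal N$, then $$\frac1n\log_2K\le E_{\max,E}(\mathcal N)+\frac1n\log_2\frac1{1-\varepsilon}.$$ 2. The supremum in the definition of $E_{\max,E}(\mathcal N)$ does not change if it is restricted to pure states $\psi$. 3. $\widetilde P_{\rm LOCC}(\mathcal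 N)\le E_{\max,E}(\mathcal N)$. -/

import Mathlib

open scoped ComplexOrder

namespace QInfo

/-! ### Trace-class operators

A quantum system with a separable Hilbert space is represented in a fixed orthonormal basis, indexed
by a countable type `ι`; its Hilbert space is `ℓ²(ι)`, of finite or countably infinite dimension.
The Hilbert space of a composite system `ℓ²(ι) ⊗ ℓ²(κ)` is then `ℓ²(ι × κ)`, and the composite of a
finite family of systems `X p` is `ℓ²(∀ p, X p)`. Operators are given by their (possibly infinite)
matrices. -/

theorem posSemidef_iff_finset {ι : Type} {M : Matrix ι ι ℂ} :
    M.PosSemidef ↔ ∀ s : Finset ι,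
      (M.submatrix (Subtype.val : s → ι) (Subtype.val : s → ι)).PosSemidef := by
  classical
  refine ⟨fun h s => h.submatrix _, fun h => ⟨?_, fun x => ?_⟩⟩
  · ext i j
    have := (h {i, j}).1
    exact congrFun (congrFun this ⟨i, by simp⟩) ⟨j, by simp⟩
  · have := (h x.support).2 (x.subtypeDomain (· ∈ x.support))
    convert this using 1
    simp only [Finsupp.sum, Finsupp.support_subtypeDomain, Finsupp.subtypeDomain_apply,
      Matrix.submatrix_apply]
    rw [← Finset.sum_coe_sort x.support]
    refine Finset.sum_congr (by ext a; simp) fun i _ => ?_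
    rw [← Finset.sum_coe_sort x.support]
    exact Finset.sum_congr (by ext a; simp) fun j _ => rfl

theorem posSemidef_contract {ι α : Type} [Fintype α] {N : Matrix (ι × α) (ι × α) ℂ}
    (hN : N.PosSemidef) (w : α → ℂ) :
    (Matrix.of fun i j : ι => ∑ a, ∑ b, star (w a) * N (i, a) (j, b) * w b).PosSemidef := by
  classical
  rw [posSemidef_iff_finset]
  intro s
  let e : s × α → ι × α := fun x => (x.1, x.2)
  obtain ⟨B, hB⟩ : ∃ B : Matrix (s × α) s ℂ, ∀ x j, B x j = if x.1 = j then w x.2 else 0 :=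
    ⟨Matrix.of fun x j => if x.1 = j then w x.2 else 0, fun _ _ => rfl⟩
  convert (hN.submatrix e).conjTranspose_mul_mul_same B using 1
  ext i j
  have h : (N.submatrix e e) * B =
      Matrix.of fun (x : s × α) (j : s) => ∑ b, N (x.1, x.2) (j, b) * w b := by
    ext x j
    simp only [Matrix.mul_apply, Matrix.submatrix_apply, Matrix.of_apply, hB, e,
      Fintype.sum_prod_type, mul_ite, mul_zero]
    rw [Finset.sum_comm]
    simp
  rw [Matrix.mul_assoc, h, Matrix.mul_apply]
  simp only [Matrix.submatrix_apply, Matrix.of_apply, Matrix.conjTranspose_apply, hB,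
    Fintype.sum_prod_type, apply_ite star, star_zero, ite_mul, zero_mul]
  rw [Finset.sum_comm]
  simp only [Finset.univ_eq_attach]
  rw [Finset.sum_comm]
  simp [Finset.mul_sum, mul_assoc]

theorem norm_sq_le_of_posSemidef {ι : Type} {T : Matrix ι ι ℂ} (hT : T.PosSemidef) (x y : ι) :
    ‖T x y‖ ^ 2 ≤ (T x x).re * (T y y).re := by
  have hd := (hT.submatrix (fun b : Bool => if b then x else y)).det_nonneg
  have hh : T y x = star (T x y) := (hT.1.apply y x).symm
  have hx := hT.diag_nonneg (i := x)
  have hy := hT.diag_nonneg (i := y)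
  rw [Complex.nonneg_iff] at hx hy
  rw [← Matrix.det_reindex_self finTwoEquiv.symm, Matrix.det_fin_two] at hd
  rw [Complex.nonneg_iff] at hd
  have h1 := hd.1
  simp [finTwoEquiv, hh, ← hx.2, ← hy.2] at h1
  rw [← Complex.normSq_eq_norm_sq, Complex.normSq_apply]
  nlinarith

/-- The trace-class operators on `ℓ²(ι)`, as matrices: the linear span of the positive operators of
finite trace. A matrix is the matrix of a positive trace-class operator if and only if it is positive
semidefinite (on finitely supported vectors) and its diagonal is summable. -/
def TraceClass (ι : Type) : Submodule ℂ (Matrix ι ι ℂ) :=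
  Submodule.span ℂ {T | T.PosSemidef ∧ Summable fun i => T i i}

/-- The trace. -/
noncomputable def tr {ι : Type} (T : TraceClass ι) : ℂ := ∑' i, T.1 i i

/-- Density operators (states): positive trace-class operators of trace one. -/
def IsState {ι : Type} (ρ : TraceClass ι) : Prop := ρ.1.PosSemidef ∧ tr ρ = 1

/-- Pure states: the projections `|v⟩⟨v|` onto unit vectors `v` of `ℓ²(ι)`. -/
def IsPure {ι : Type} (ρ : TraceClass ι) : Prop :=
  ∃ v : ι → ℂ, HasSum (fun x => ‖v x‖ ^ 2) 1 ∧ ∀ x y, ρ.1 x y = v x * star (v y)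

theorem TraceClass.summable_diag {ι : Type} {T : Matrix ι ι ℂ} (hT : T ∈ TraceClass ι) :
    Summable fun i => T i i := by
  induction hT using Submodule.span_induction with
  | mem x h => exact h.2
  | zero => simp
  | add x y _ _ hx hy => exact hx.add hy
  | smul a x _ hx => exact hx.mul_left a

theorem TraceClass.submatrix_mem {ι κ : Type} {T : Matrix κ κ ℂ} (hT : T ∈ TraceClass κ)
    {f g : ι → κ} (hf : f.Injective) (hg : g.Injective) : T.submatrix f g ∈ TraceClass ι := by
  induction hT using Submodule.span_induction with
  | zero => simp
  | add x y _ _ hx hy => exact Submodule.add_mem _ hx hy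
  | smul a x _ hx => exact Submodule.smul_mem _ a hx
  | mem T h =>
    obtain ⟨hT, hs⟩ := h
    let e : ι × Bool → κ := fun x => if x.2 then f x.1 else g x.1
    have key (c : ℂ) : T.submatrix f f + star c • T.submatrix g f + c • T.submatrix f g +
        (star c * c) • T.submatrix g g ∈ TraceClass ι := by
      refine Submodule.subset_span ⟨?_, ?_⟩
      · convert posSemidef_contract (hT.submatrix e) (fun b => if b then 1 else c) using 1
        ext i j
        simp [e]
        ring
      · have h1 (a b : ι → κ) (ha : a.Injective) (hb : b.Injective) :
            Summable fun i => T (a i) (b i) := by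
          have hpos (i : κ) : 0 ≤ T i i := hT.diag_nonneg
          have hre : Summable fun i => (T i i).re := (Complex.reCLM.summable hs)
          refine Summable.of_norm_bounded ((hre.comp_injective ha).add (hre.comp_injective hb))
            fun i => ?_
          have h2 := norm_sq_le_of_posSemidef hT (a i) (b i)
          have ha := (Complex.nonneg_iff.1 (hpos (a i))).1
          have hb := (Complex.nonneg_iff.1 (hpos (b i))).1
          simp only [Function.comp_apply]
          nlinarith [norm_nonneg (T (a i) (b i))]
        exact (((h1 f f hf hf).add ((h1 g f hg hf).mul_left _)).add
          ((h1 f g hf hg).mul_left _)).add ((h1 g g hg hg).mul_left _)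
    have : T.submatrix f g = (1 / 4 : ℂ) • ((T.submatrix f f + star (1 : ℂ) • T.submatrix g f
        + (1 : ℂ) • T.submatrix f g + (star (1 : ℂ) * 1) • T.submatrix g g)
        - (T.submatrix f f + star (-1 : ℂ) • T.submatrix g f + (-1 : ℂ) • T.submatrix f g +
          (star (-1 : ℂ) * (-1)) • T.submatrix g g)
        - Complex.I • (T.submatrix f f + star Complex.I • T.submatrix g f
          + Complex.I • T.submatrix f g + (star Complex.I * Complex.I) • T.submatrix g g)
        + Complex.I • (T.submatrix f f + star (-Complex.I) • T.submatrix g f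
          + (-Complex.I) • T.submatrix f g
          + (star (-Complex.I) * (-Complex.I)) • T.submatrix g g)) := by
      ext i j
      simp
      ring_nf
      simp
      ring_nf
    rw [this]
    refine Submodule.smul_mem _ _ (Submodule.add_mem _ (Submodule.sub_mem _ (Submodule.sub_mem _
      (key _) (key _)) (Submodule.smul_mem _ _ (key _))) (Submodule.smul_mem _ _ (key _)))



/-- The block `(⟨l| ⊗ 1) T (|m⟩ ⊗ 1)` of a trace-class operator `T` on `ℓ²(L) ⊗ ℓ²(ι)`. -/
def TraceClass.block {L ι : Type} (T : TraceClass (L × ι)) (l m : L) : TraceClass ι :=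
  ⟨T.1.submatrix (fun i => (l, i)) (fun j => (m, j)),
    TraceClass.submatrix_mem T.2 (Prod.mk_right_injective l) (Prod.mk_right_injective m)⟩

/-- Relabelling of the basis (a canonical unitary identification of systems). -/
def TraceClass.reindex {ι κ : Type} (e : ι ≃ κ) (T : TraceClass ι) : TraceClass κ :=
  ⟨T.1.submatrix e.symm e.symm,
    TraceClass.submatrix_mem T.2 e.symm.injective e.symm.injective⟩

/-! ### Quantum channels -/

/-- Complete positivity: `id ⊗ Φ` is positive on `ℂⁿ ⊗ ℓ²(ι)` for every `n`. -/
def IsCP {ι κ : Type} (Φ : TraceClass ι →ₗ[ℂ] TraceClass κ) : Prop :=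
  ∀ (n : ℕ) (T : Fin n → Fin n → TraceClass ι),
    (Matrix.of fun u v : Fin n × ι => (T u.1 v.1).1 u.2 v.2).PosSemidef →
    (Matrix.of fun u v : Fin n × κ => (Φ (T u.1 v.1)).1 u.2 v.2).PosSemidef

/-- Trace non-increasing on positive operators. -/
def IsTraceNonincreasing {ι κ : Type} (Φ : TraceClass ι →ₗ[ℂ] TraceClass κ) : Prop :=
  ∀ T : TraceClass ι, T.1.PosSemidef → (tr (Φ T)).re ≤ (tr T).re

/-- A quantum channel: a completely positive, trace-preserving linear map between trace classes. -/
structure Channel (ι κ : Type) where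
  toLin : TraceClass ι →ₗ[ℂ] TraceClass κ
  cp : IsCP toLin
  tp : ∀ T, tr (toLin T) = tr T

theorem IsCP.posSemidef_ampliate {L ι κ : Type} {Φ : TraceClass ι →ₗ[ℂ] TraceClass κ}
    (hΦ : IsCP Φ) (T : TraceClass (L × ι)) (hT : T.1.PosSemidef) :
    (Matrix.of fun u v : L × κ => (Φ (TraceClass.block T u.1 v.1)).1 u.2 v.2).PosSemidef := by
  classical
  rw [posSemidef_iff_finset]
  intro s
  let t := s.image Prod.fst
  let e := t.equivFin
  have h := hΦ t.card (fun a b => TraceClass.block T (e.symm a) (e.symm b))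
    (hT.submatrix fun u : Fin t.card × ι => ((e.symm u.1 : L), u.2))
  let f : s → Fin t.card × κ := fun u =>
    (e ⟨u.1.1, Finset.mem_image_of_mem _ u.2⟩, u.1.2)
  convert h.submatrix f using 1
  ext u v
  simp [f]

theorem Channel.ampliate_mem {L ι κ : Type} (N : Channel ι κ) (T : TraceClass (L × ι)) :
    (Matrix.of fun u v : L × κ => (N.toLin (TraceClass.block T u.1 v.1)).1 u.2 v.2) ∈
      TraceClass (L × κ) := by
  obtain ⟨T, hT⟩ := T
  induction hT using Submodule.span_induction with
  | zero =>
    convert Submodule.zero_mem _ using 1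
    ext u v
    have : TraceClass.block (⟨0, Submodule.zero_mem _⟩ : TraceClass (L × ι)) u.1 v.1 = 0 := rfl
    simp [this]
  | add x y hx hy h h' =>
    convert Submodule.add_mem _ h h' using 1
    ext u v
    have : TraceClass.block (⟨x + y, Submodule.add_mem _ hx hy⟩ : TraceClass (L × ι)) u.1 v.1
      = TraceClass.block ⟨x, hx⟩ u.1 v.1 + TraceClass.block ⟨y, hy⟩ u.1 v.1 := rfl
    simp [this]
  | smul a x hx h =>
    convert Submodule.smul_mem _ a h using 1
    ext u v
    have : TraceClass.block (⟨a • x, Submodule.smul_mem _ a hx⟩ : TraceClass (L × ι)) u.1 v.1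
      = a • TraceClass.block ⟨x, hx⟩ u.1 v.1 := rfl
    simp [this]
  | mem T h =>
    have hT : T ∈ TraceClass (L × ι) := Submodule.subset_span h
    have hpos := N.cp.posSemidef_ampliate ⟨T, hT⟩ h.1
    refine Submodule.subset_span ⟨hpos, ?_⟩
    have him (i) := (Complex.nonneg_iff.1 (hpos.diag_nonneg (i := i))).2
    have hre (i) := (Complex.nonneg_iff.1 (hpos.diag_nonneg (i := i))).1
    suffices Summable fun i => ((Matrix.of fun u v : L × κ =>
        (N.toLin (TraceClass.block ⟨T, hT⟩ u.1 v.1)).1 u.2 v.2) i i).re by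
      convert Complex.ofRealCLM.summable this using 1
      ext i
      exact Complex.ext rfl (him i).symm
    rw [summable_prod_of_nonneg hre]
    refine ⟨fun l => Complex.reCLM.summable (TraceClass.summable_diag
      (N.toLin (TraceClass.block ⟨T, hT⟩ l l)).2), ?_⟩
    have hs : Summable fun u : L × ι => (T u u).re := Complex.reCLM.summable h.2
    refine hs.prod.congr fun l => ?_
    have h1 := congrArg Complex.re (N.tp (TraceClass.block ⟨T, hT⟩ l l))
    unfold tr at h1
    rw [Complex.re_tsum (TraceClass.summable_diag (N.toLin _).2),
      Complex.re_tsum (TraceClass.summable_diag (TraceClass.block _ l l).2)] at h1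
    exact h1.symm

/-- The map `id ⊗ N` from the trace class of `ℓ²(L) ⊗ ℓ²(ι)` to that of `ℓ²(L) ⊗ ℓ²(κ)`:
the channel `N` is applied to every block. -/
def Channel.ampliate {ι κ : Type} (L : Type) (N : Channel ι κ) (T : TraceClass (L × ι)) :
    TraceClass (L × κ) :=
  ⟨Matrix.of fun u v : L × κ => (N.toLin (TraceClass.block T u.1 v.1)).1 u.2 v.2,
    N.ampliate_mem T⟩

/-- The tuple of pairs `(Q p, I p)` regarded as the pair of tuples. -/
def pairEquiv {P : Type} (Q I : P → Type) : (∀ p, Q p × I p) ≃ (∀ p, Q p) × (∀ p, I p) where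
  toFun z := (fun p => (z p).1, fun p => (z p).2)
  invFun z := fun p => (z.1 p, z.2 p)
  left_inv _ := rfl
  right_inv _ := rfl

/-- A multipartite channel acts on the `I`-systems of the parties, while each party `p` keeps
its reference system `Q p`. -/
def Channel.onShares {P : Type} {I O : P → Type} (N : Channel (∀ p, I p) (∀ p, O p))
    (Q : P → Type) (ρ : TraceClass (∀ p, Q p × I p)) : TraceClass (∀ p, Q p × O p) :=
  TraceClass.reindex (pairEquiv Q O).symm
    (N.ampliate (∀ p, Q p) (TraceClass.reindex (pairEquiv Q I) ρ))

/-! ### Fully separable states, LOCC channels, max-relative entropy -/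

/-- Fully separable states of the parties `p : P` holding the systems `X p`: (countable) convex
combinations `∑ⱼ wⱼ ⨂ₚ |ψʲₚ⟩⟨ψʲₚ|` of product pure states. -/
def IsFullySeparable {P : Type} [Fintype P] {X : P → Type} (ρ : TraceClass (∀ p, X p)) : Prop :=
  ∃ (J : Type) (_ : Countable J) (w : J → ℝ) (ψ : J → ∀ p, X p → ℂ),
    (∀ j, 0 ≤ w j) ∧ HasSum w 1 ∧ (∀ j p, HasSum (fun x => ‖ψ j p x‖ ^ 2) 1) ∧
    ∀ x y, HasSum (fun j => (w j : ℂ) * ∏ p, (ψ j p (x p) * star (ψ j p (y p)))) (ρ.1 x y)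

/-- LOCC channels in the form `∑ₓ ⨂ₚ E p x`, with `x` in a countable set of classical outcomes and
each `E p x` a completely positive trace non-increasing map of party `p`. A channel, being bounded
in trace norm, is determined by its values on product operators, and these values
are `∑ₓ ⨂ₚ E p x (T p)`. -/
def IsLOCC {P : Type} [Fintype P] {X Y : P → Type} (Λ : Channel (∀ p, X p) (∀ p, Y p)) : Prop :=
  ∃ (J : Type) (_ : Countable J) (E : ∀ p, J → (TraceClass (X p) →ₗ[ℂ] TraceClass (Y p))),
    (∀ p j, IsCP (E p j) ∧ IsTraceNonincreasing (E p j)) ∧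
    ∀ (T : ∀ p, TraceClass (X p)) (S : TraceClass (∀ p, X p)),
      (∀ x y, S.1 x y = ∏ p, (T p).1 (x p) (y p)) →
      ∀ x y, HasSum (fun j => ∏ p, (E p j (T p)).1 (x p) (y p)) ((Λ.toLin S).1 x y)

/-- The max-relative entropy `inf {l : ρ ≤ 2 ^ l σ}`, which is `⊤` if there is no such `l`. -/
noncomputable def maxRelEntropy {ι : Type} (ρ σ : TraceClass ι) : EReal :=
  ⨅ (l : ℝ) (_ : ((((2 : ℝ) ^ l : ℝ) : ℂ) • σ.1 - ρ.1).PosSemidef), (l : EReal)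

/-- The max-relative entropy of entanglement of a multipartite state. -/
noncomputable def maxEntanglement {P : Type} [Fintype P] {X : P → Type}
    (ρ : TraceClass (∀ p, X p)) : EReal :=
  ⨅ (σ : TraceClass (∀ p, X p)) (_ : IsFullySeparable σ), maxRelEntropy ρ σ

/-! ### Fidelity -/

open Classical in
/-- The vectors of the standard orthonormal basis of `ℓ²(ι)`. -/
noncomputable def ket {ι : Type} (i : ι) : lp (fun _ : ι => ℂ) 2 := lp.single 2 i 1

/-- The matrix entries `⟨i| A |j⟩` of a bounded operator. -/
noncomputable def entry {ι : Type} (A : lp (fun _ : ι => ℂ) 2 →L[ℂ] lp (fun _ : ι => ℂ) 2)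
    (i j : ι) : ℂ := inner ℂ (ket i) (A (ket j))

theorem TraceClass.exists_operator {ι : Type} (T : TraceClass ι) :
    ∃ A : lp (fun _ : ι => ℂ) 2 →L[ℂ] lp (fun _ : ι => ℂ) 2,
      ∀ i j, entry A i j = T.1 i j := by
  classical
  suffices h : ∃ A : lp (fun _ : ι => ℂ) 2 →L[ℂ] lp (fun _ : ι => ℂ) 2,
      ∀ i j, A (lp.single 2 j 1) i = T.1 i j by
    obtain ⟨A, hA⟩ := h
    refine ⟨A, fun i j => ?_⟩
    rw [← hA i j]
    simp only [entry, ket]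
    convert lp.inner_single_left (𝕜 := ℂ) (G := fun _ : ι => ℂ) i 1 _ using 1
    simp
  obtain ⟨T, hT⟩ := T
  dsimp only
  induction hT using Submodule.span_induction with
  | zero => exact ⟨0, by simp⟩
  | add x y _ _ hx hy =>
    obtain ⟨A, hA⟩ := hx
    obtain ⟨B, hB⟩ := hy
    exact ⟨A + B, fun i j => by simp [hA, hB]⟩
  | smul a x _ hx =>
    obtain ⟨A, hA⟩ := hx
    exact ⟨a • A, fun i j => by simp [hA]⟩
  | mem T h =>
    obtain ⟨hT, hs⟩ := h
    have hpos (i : ι) : 0 ≤ (T i i).re := (Complex.nonneg_iff.1 hT.diag_nonneg).1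
    have hre : Summable fun i => (T i i).re := Complex.reCLM.summable hs
    have h2 : (0 : ℝ) < (2 : ENNReal).toReal := by norm_num
    have hd : Memℓp (fun i => ((Real.sqrt (T i i).re : ℝ) : ℂ)) 2 := by
      rw [memℓp_gen_iff h2]
      simpa [abs_of_nonneg, Real.sq_sqrt, hpos] using hre
    let d : lp (fun _ : ι => ℂ) 2 := ⟨_, hd⟩
    have hT' (i j : ι) : ‖T i j‖ ≤ ‖d i‖ * ‖d j‖ := by
      have := Real.le_sqrt_of_sq_le (norm_sq_le_of_posSemidef hT i j)
      rw [Real.sqrt_mul (hpos i)] at this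
      simpa [d, abs_of_nonneg, Real.sqrt_nonneg] using this
    have hrow (i : ι) : Memℓp (fun j => star (T i j)) 2 := by
      refine (memℓp_gen_iff h2).2 (Summable.of_nonneg_of_le (fun _ => by positivity)
        (fun j => ?_) (((memℓp_gen_iff h2).1 (lp.memℓp d)).mul_left (‖d i‖ ^ (2 : ℝ))))
      rw [norm_star]
      simp only [ENNReal.toReal_ofNat]
      rw [← Real.mul_rpow (norm_nonneg _) (norm_nonneg _)]
      exact Real.rpow_le_rpow (norm_nonneg _) (hT' i j) (by norm_num)
    let r (i : ι) : lp (fun _ : ι => ℂ) 2 := ⟨_, hrow i⟩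
    have hr (i : ι) : ‖r i‖ ≤ ‖d i‖ * ‖d‖ := by
      have h := lp.norm_rpow_eq_tsum h2 (r i)
      have h' := lp.norm_rpow_eq_tsum h2 d
      have : ‖r i‖ ^ (2 : ENNReal).toReal ≤ (‖d i‖ * ‖d‖) ^ (2 : ENNReal).toReal := by
        rw [Real.mul_rpow (norm_nonneg _) (norm_nonneg _), h, h', ← tsum_mul_left]
        refine Summable.tsum_le_tsum (fun j => ?_) ((memℓp_gen_iff h2).1 (lp.memℓp (r i)))
          (((memℓp_gen_iff h2).1 (lp.memℓp d)).mul_left _)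
        rw [← Real.mul_rpow (norm_nonneg _) (norm_nonneg _)]
        refine Real.rpow_le_rpow (norm_nonneg _) ?_ h2.le
        simpa [r] using hT' i j
      exact (Real.rpow_le_rpow_iff (norm_nonneg _) (by positivity) h2).1 this
    have hin (i : ι) (x : lp (fun _ : ι => ℂ) 2) :
        ‖inner ℂ (r i) x‖ ≤ ‖((‖d‖ * ‖x‖ : ℝ) : ℂ) • d i‖ := by
      refine (norm_inner_le_norm _ _).trans ?_
      rw [norm_smul, Complex.norm_real, Real.norm_of_nonneg (by positivity)]
      nlinarith [mul_le_mul_of_nonneg_right (hr i) (norm_nonneg x)]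
    have hmem (x : lp (fun _ : ι => ℂ) 2) : Memℓp (fun i => inner ℂ (r i) x) 2 := by
      refine (memℓp_gen_iff h2).2 (Summable.of_nonneg_of_le (fun _ => by positivity)
        (fun j => ?_) ((memℓp_gen_iff h2).1 (lp.memℓp (((‖d‖ * ‖x‖ : ℝ) : ℂ) • d))))
      exact Real.rpow_le_rpow (norm_nonneg _) (hin j x) h2.le
    let A : lp (fun _ : ι => ℂ) 2 →ₗ[ℂ] lp (fun _ : ι => ℂ) 2 :=
      { toFun := fun x => ⟨_, hmem x⟩
        map_add' := fun x y => by ext i; exact inner_add_right _ _ _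
        map_smul' := fun a x => by ext i; exact inner_smul_right _ _ _ }
    refine ⟨A.mkContinuous (‖d‖ * ‖d‖) fun x => ?_, fun i j => ?_⟩
    · have : ‖A x‖ ≤ ‖((‖d‖ * ‖x‖ : ℝ) : ℂ) • d‖ := by
        rw [← Real.rpow_le_rpow_iff (norm_nonneg _) (norm_nonneg _) h2,
          lp.norm_rpow_eq_tsum h2, lp.norm_rpow_eq_tsum h2]
        exact Summable.tsum_le_tsum
          (fun i => Real.rpow_le_rpow (norm_nonneg _) (hin i x) h2.le)
          ((memℓp_gen_iff h2).1 (lp.memℓp _)) ((memℓp_gen_iff h2).1 (lp.memℓp _))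
      refine this.trans_eq ?_
      rw [norm_smul, Complex.norm_real, Real.norm_of_nonneg (by positivity)]
      ring
    · change inner ℂ (r i) (lp.single 2 j 1) = T i j
      rw [lp.inner_single_right]
      simp [r]

/-- The bounded operator on `ℓ²(ι)` with the matrix `T` (it is unique). -/
noncomputable def TraceClass.op {ι : Type} (T : TraceClass ι) :
    lp (fun _ : ι => ℂ) 2 →L[ℂ] lp (fun _ : ι => ℂ) 2 :=
  (TraceClass.exists_operator T).choose

/-- The positive square root of a positive bounded operator. -/
noncomputable def opSqrt {H : Type} [NormedAddCommGroup H] [InnerProductSpace ℂ H]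
    [CompleteSpace H] (A : H →L[ℂ] H) : H →L[ℂ] H := CFC.sqrt A

/-- The fidelity `F(ρ, σ) = (Tr √(√σ ρ √σ))²`. -/
noncomputable def fidelity {ι : Type} (ρ σ : TraceClass ι) : ℝ :=
  (∑' i, (entry (opSqrt (opSqrt (TraceClass.op σ) * TraceClass.op ρ *
    opSqrt (TraceClass.op σ))) i i).re) ^ 2

/-! ### Private states and secret-key-agreement protocols -/

open Classical in
/-- The amplitudes of the GHZ vector `K^(-1/2) ∑_c |c,…,c⟩`. -/
noncomputable def ghz {P : Type} (K : ℕ) (k : P → Fin K) : ℂ :=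
  if ∃ c, ∀ p, k p = c then (((Real.sqrt K)⁻¹ : ℝ) : ℂ) else 0

/-- Private states of the parties `p : P` with `K`-dimensional key systems and shield systems `S p`:
`U (Φ ⊗ ω) U*` with `Φ` the GHZ state of the key systems, `ω` a state of the shield systems and
`U = ∑_k |k⟩⟨k| ⊗ V k` a twisting unitary, `k` running through the tuples of key values. -/
def IsPrivateState {P : Type} {K : ℕ} {S : P → Type}
    (γ : TraceClass (∀ p, Fin K × S p)) : Prop :=
  ∃ (ω : TraceClass (∀ p, S p))
    (V : (P → Fin K) → unitary (lp (fun _ : ∀ p, S p => ℂ) 2 →L[ℂ] lp (fun _ : ∀ p, S p => ℂ) 2)),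
    IsState ω ∧
    ∀ x y : ∀ p, Fin K × S p,
      γ.1 x y = ghz K (fun p => (x p).1) * star (ghz K (fun p => (y p).1)) *
        entry ((V fun p => (x p).1).1 * TraceClass.op ω * star (V fun p => (y p).1).1)
          (fun p => (x p).2) (fun p => (y p).2)

/-- `IsProtocolInput N n Q ρ`: the state `ρ`, with reference systems `Q p`, can be the input of the
`n`-th use of `N` in an LOCC-assisted protocol. The input of the first use is fully separable; the
input of every further use is obtained from the output of the previous use by an LOCC channel. -/
inductive IsProtocolInput {P : Type} [Fintype P] {I O : P → Type}
    (N : Channel (∀ p, I p) (∀ p, O p)) :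
    ℕ → ∀ Q : P → Type, TraceClass (∀ p, Q p × I p) → Prop
  | first (Q : P → Type) (hQ : ∀ p, Countable (Q p)) (ρ : TraceClass (∀ p, Q p × I p))
      (hρ : IsFullySeparable ρ) : IsProtocolInput N 1 Q ρ
  | next {n : ℕ} {Q : P → Type} {ρ : TraceClass (∀ p, Q p × I p)}
      (h : IsProtocolInput N n Q ρ) (Q' : P → Type) (hQ' : ∀ p, Countable (Q' p))
      (Λ : Channel (∀ p, Q p × O p) (∀ p, Q' p × I p)) (hΛ : IsLOCC Λ) :
      IsProtocolInput N (n + 1) Q' (Λ.toLin (N.onShares Q ρ))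

/-- There is an `(n, K, ε)` LOCC-assisted secret-key-agreement protocol over `N`: after `n` uses of
`N` a last LOCC channel yields a state `ω` of key and shield systems for which some private
state `γ` satisfies `F(γ, ω) ≥ 1 - ε`. -/
def HasProtocol {P : Type} [Fintype P] {I O : P → Type} (N : Channel (∀ p, I p) (∀ p, O p))
    (n K : ℕ) (ε : ℝ) : Prop :=
  ∃ (Q : P → Type) (ρ : TraceClass (∀ p, Q p × I p)) (S : P → Type)
    (D : Channel (∀ p, Q p × O p) (∀ p, Fin K × S p)) (γ : TraceClass (∀ p, Fin K × S p)),
    IsProtocolInput N n Q ρ ∧ (∀ p, Countable (S p)) ∧ IsLOCC D ∧ IsPrivateState γ ∧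
    1 - ε ≤ fidelity γ (D.toLin (N.onShares Q ρ))

/-- `R` is a strong converse rate: for all `ε ∈ [0, 1)` and `δ > 0` and all sufficiently large `n`
there is no `(n, K, ε)` protocol with `K ≥ 2 ^ (n (R + δ))`. -/
def IsStrongConverseRate {P : Type} [Fintype P] {I O : P → Type}
    (N : Channel (∀ p, I p) (∀ p, O p)) (R : ℝ) : Prop :=
  ∀ ε : ℝ, 0 ≤ ε → ε < 1 → ∀ δ : ℝ, 0 < δ → ∀ᶠ n : ℕ in Filter.atTop,
    ∀ K : ℕ, (2 : ℝ) ^ ((n : ℝ) * (R + δ)) ≤ (K : ℝ) → ¬ HasProtocol N n K ε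

/-- The strong converse LOCC-assisted secret-key-agreement capacity: the infimum of all strong
converse rates. -/
noncomputable def strongConverseCapacity {P : Type} [Fintype P] {I O : P → Type}
    (N : Channel (∀ p, I p) (∀ p, O p)) : EReal :=
  ⨅ (R : ℝ) (_ : IsStrongConverseRate N R), (R : EReal)

/-! ### Multiplex channels -/

section Multiplex

/-- The channel inputs: `A' a` for the sender-receivers, `B b` for the senders, and the trivial
system `ℂ` for the receivers. -/
def InSys {𝒜 ℬ : Type} (𝒞 : Type) (A' : 𝒜 → Type) (B : ℬ → Type) : 𝒜 ⊕ ℬ ⊕ 𝒞 → Type :=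
  Sum.elim A' (Sum.elim B fun _ => Unit)

/-- The channel outputs: `A a` for the sender-receivers, the trivial system `ℂ` for the senders, and
`C c` for the receivers. -/
def OutSys {𝒜 𝒞 : Type} (ℬ : Type) (A : 𝒜 → Type) (C : 𝒞 → Type) : 𝒜 ⊕ ℬ ⊕ 𝒞 → Type :=
  Sum.elim A (Sum.elim (fun _ => Unit) C)

/-- A multiplex channel `N : A' B → A C`. -/
abbrev MultiplexChannel {𝒜 ℬ 𝒞 : Type} (A' A : 𝒜 → Type) (B : ℬ → Type) (C : 𝒞 → Type) : Type :=
  Channel (∀ p, InSys 𝒞 A' B p) (∀ p, OutSys ℬ A C p)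

/-- The reference systems `L a` of the sender-receivers and `R b` of the senders; the receivers
have none. -/
abbrev RefSys {𝒜 ℬ : Type} (𝒞 : Type) (L : 𝒜 → Type) (R : ℬ → Type) : 𝒜 ⊕ ℬ ⊕ 𝒞 → Type :=
  InSys 𝒞 L R

variable {𝒜 ℬ 𝒞 : Type} [Fintype 𝒜] [Fintype ℬ] [Fintype 𝒞]
  {A' A : 𝒜 → Type} {B : ℬ → Type} {C : 𝒞 → Type}

/-- The max-relative entropy of entanglement `E_max,E(N)` of a multiplex channel: the supremum over
all separable reference systems and all fully separable input states `ψ` (with respect to the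
partition `:LA':RB:`) of the max-relative entropy of entanglement of `N(ψ)` (with respect to the
partition `:LA:R:C:`). -/
noncomputable def channelMaxEntanglement (N : MultiplexChannel A' A B C) : EReal :=
  ⨆ (L : 𝒜 → Type) (R : ℬ → Type) (_ : ∀ a, Countable (L a)) (_ : ∀ b, Countable (R b))
    (ψ : TraceClass (∀ p, RefSys 𝒞 L R p × InSys 𝒞 A' B p)) (_ : IsFullySeparable ψ),
    maxEntanglement (N.onShares (RefSys 𝒞 L R) ψ)

/-- The same supremum, over pure fully separable input states only. -/
noncomputable def channelMaxEntanglementPure (N : MultiplexChannel A' A B C) : EReal :=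
  ⨆ (L : 𝒜 → Type) (R : ℬ → Type) (_ : ∀ a, Countable (L a)) (_ : ∀ b, Countable (R b))
    (ψ : TraceClass (∀ p, RefSys 𝒞 L R p × InSys 𝒞 A' B p))
    (_ : IsFullySeparable ψ ∧ IsPure ψ),
    maxEntanglement (N.onShares (RefSys 𝒞 L R) ψ)

end Multiplex

end QInfo

namespace QInfo

/-! ### Entrywise sums of positive semidefinite matrices -/

/-! The quantity that controls a protocol is the least factor `c` with `ρ ≤ c σ` for some fully
separable `σ`. LOCC channels do not increase it, since they are positive and preserve full
separability (`IsLOCC.isFullySeparable`). For real `l` strictly above the channel quantity, one use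
of `N` multiplies it by at most `2 ^ l`: from `ρ ≤ c σ` follows `N(ρ) ≤ c N(σ)`, and `N(σ) ≤ 2 ^ l
τ` because `σ` is itself a fully separable input. So after `n` uses the final state lies below `2 ^
(l n)` times a fully separable state.

The privacy test turns this into a bound on `K`. A private state is `T* ω₀ T` with `T = (⟨GHZ| ⊗ 1)
U*`, and Hölder's inequality gives `F(γ, ω) ≤ Tr T ω T*`. For a product unit vector `ψ`,
Cauchy–Schwarz for the key distributions of two parties gives `‖T ψ‖² ≤ 1 / K`, so a fully separable
state passes with probability at most `1 / K`. Hence `1 - ε ≤ 2 ^ (l n) / K`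
(`IsPrivateState.fidelity_le`, `HasProtocol.le_of_lt`).

Two points connect this to the channel quantity, both in `exists_isFullySeparable_onShares`. A fully
separable input is a mixture of pure product inputs, and a common `l` allows the dominating states
to be mixed with the same weights; this is also the reduction to pure inputs. And in a protocol the
receivers keep memories, which the definition does not give them; on a product input these are
tensor factors and split off.

In infinite dimension convergence is handled entrywise: entries of a positive matrix are controlled
by its diagonal, and diagonals are nonnegative series. -/

theorem hasSum_fin_prod (n : ℕ) (κ : Fin n → Type) (f : ∀ p, κ p → ℂ) (a : Fin n → ℂ)
    (hs : ∀ p, Summable fun k => ‖f p k‖) (h : ∀ p, HasSum (f p) (a p)) :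
    Summable (fun k : ∀ p, κ p => ‖∏ p, f p (k p)‖) ∧
      HasSum (fun k : ∀ p, κ p => ∏ p, f p (k p)) (∏ p, a p) := by
  induction n with
  | zero =>
    simp only [Finset.univ_eq_empty, Finset.prod_empty]
    exact ⟨(hasSum_fintype _).summable, by simp⟩
  | succ n ih =>
    obtain ⟨h1, h2⟩ := ih (fun x => κ x.succ) (fun x => f x.succ) (fun x => a x.succ)
      (fun _ => hs _) (fun _ => h _)
    have h3 := Summable.mul_norm (f := f 0) (hs 0) h1
    have h4 := (h 0).mul h2 h3.of_norm
    rw [← (Fin.consEquiv κ).summable_iff, ← (Fin.consEquiv κ).hasSum_iff]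
    simp only [Fin.prod_univ_succ, Function.comp_def, Fin.consEquiv, Equiv.coe_fn_mk, Fin.cons_zero,
      Fin.cons_succ]
    exact ⟨h3, h4⟩

theorem hasSum_pi_prod {P : Type} [Fintype P] {κ : P → Type} {f : ∀ p, κ p → ℂ} {a : P → ℂ}
    (hs : ∀ p, Summable fun k => ‖f p k‖) (h : ∀ p, HasSum (f p) (a p)) :
    HasSum (fun k : ∀ p, κ p => ∏ p, f p (k p)) (∏ p, a p) := by
  have h1 := (hasSum_fin_prod _ (fun x => κ ((Fintype.equivFin P).symm x)) (fun x => f _)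
    (fun x => a _) (fun _ => hs _) (fun _ => h _)).2
  rw [(Fintype.equivFin P).symm.prod_comp] at h1
  rw [← (Equiv.piCongrLeft κ (Fintype.equivFin P).symm).hasSum_iff]
  refine (congrArg₂ HasSum (funext fun k => ?_) rfl).mp h1
  rw [Function.comp_apply, ← (Fintype.equivFin P).symm.prod_comp]
  exact Finset.prod_congr rfl fun x _ => by rw [Equiv.piCongrLeft_apply_apply]

theorem hasSum_pi_prod_real {P : Type} [Fintype P] {κ : P → Type} {f : ∀ p, κ p → ℝ} {a : P → ℝ}
    (hf : ∀ p k, 0 ≤ f p k) (h : ∀ p, HasSum (f p) (a p)) :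
    HasSum (fun k : ∀ p, κ p => ∏ p, f p (k p)) (∏ p, a p) := by
  have := hasSum_pi_prod (f := fun p k => (f p k : ℂ)) (a := fun p => (a p : ℂ))
    (fun p => by simpa [abs_of_nonneg, hf] using (h p).summable)
    (fun p => Complex.hasSum_ofReal.2 (h p))
  rw [← Complex.hasSum_ofReal]
  simpa using this

/-- Interchange of the order of summation for nonnegative double series. -/
theorem hasSum_comm_of_nonneg {J X : Type} {f : J → X → ℝ} {g : X → ℝ} {h : J → ℝ} {a : ℝ}
    (hf : ∀ j x, 0 ≤ f j x) (h1 : ∀ x, HasSum (fun j => f j x) (g x)) (h2 : HasSum g a)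
    (h3 : ∀ j, HasSum (f j) (h j)) : HasSum h a := by
  have hs : Summable fun z : X × J => f z.2 z.1 := by
    rw [summable_prod_of_nonneg fun _ => hf _ _]
    refine ⟨fun x => (h1 x).summable, ?_⟩
    simpa only [(h1 _).tsum_eq] using h2.summable
  have ha : HasSum (fun z : X × J => f z.2 z.1) a := by
    have := hs.hasSum.prod_fiberwise h1
    rw [h2.unique this]
    exact hs.hasSum
  rw [← (Equiv.prodComm J X).hasSum_iff] at ha
  exact ha.prod_fiberwise h3

theorem _root_.Matrix.PosSemidef.ofReal_re_diag {ι : Type} {M : Matrix ι ι ℂ} (hM : M.PosSemidef)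
    (x : ι) : ((M x x).re : ℂ) = M x x :=
  Complex.ext rfl (Complex.nonneg_iff.1 (hM.diag_nonneg (i := x))).2

theorem _root_.Matrix.PosSemidef.re_diag_nonneg {ι : Type} {M : Matrix ι ι ℂ} (hM : M.PosSemidef)
    (x : ι) : 0 ≤ (M x x).re :=
  (Complex.nonneg_iff.1 (hM.diag_nonneg (i := x))).1

theorem norm_le_half_diag {ι : Type} {M : Matrix ι ι ℂ} (hM : M.PosSemidef) (x y : ι) :
    ‖M x y‖ ≤ ((M x x).re + (M y y).re) / 2 := by
  have h := norm_sq_le_of_posSemidef hM x y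
  have hx := hM.re_diag_nonneg x
  have hy := hM.re_diag_nonneg y
  nlinarith [norm_nonneg (M x y), sq_nonneg ((M x x).re - (M y y).re)]

/-- The quadratic form is tested on finitely supported vectors only, where it is a finite
combination of entries, so entrywise convergence suffices. -/
theorem posSemidef_of_hasSum {J ι : Type} {f : J → Matrix ι ι ℂ} {M : Matrix ι ι ℂ}
    (hf : ∀ j, (f j).PosSemidef) (h : ∀ x y, HasSum (fun j => f j x y) (M x y)) :
    M.PosSemidef := by
  refine ⟨?_, fun v => ?_⟩
  · ext x y
    refine HasSum.unique ?_ (h x y)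
    have h1 := (h y x).star
    simp only [fun j => (hf j).1.apply x y] at h1
    exact h1
  · have h1 : HasSum (fun j => v.sum fun a xa => v.sum fun b xb => star xa * f j a b * xb)
        (v.sum fun a xa => v.sum fun b xb => star xa * M a b * xb) := by
      simp only [Finsupp.sum]
      exact hasSum_sum fun a _ => hasSum_sum fun b _ => ((h a b).mul_left _).mul_right _
    exact h1.nonneg fun j => (hf j).2 v

theorem posSemidef_congruence {ι : Type} {M : Matrix ι ι ℂ} (hM : M.PosSemidef) (v : ι → ℂ) :
    (Matrix.of fun x y => v x * M x y * star (v y)).PosSemidef := by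
  classical
  rw [posSemidef_iff_finset] at hM ⊢
  intro s
  convert (hM s).mul_mul_conjTranspose_same (Matrix.diagonal fun x : s => v x) using 1
  ext x y
  simp [Matrix.diagonal_conjTranspose]

theorem posSemidef_rankOne {ι : Type} (v : ι → ℂ) :
    (Matrix.of fun x y => v x * star (v y)).PosSemidef := by
  have h1 : (Matrix.of fun _ _ : Unit => (1 : ℂ)).PosSemidef := by
    convert Matrix.PosSemidef.one (n := Unit) (R := ℂ) using 1
    ext
    simp
  convert posSemidef_congruence (h1.submatrix fun _ : ι => ()) v using 1
  ext
  simp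

theorem posSemidef_ofReal_smul {ι : Type} {M : Matrix ι ι ℂ} (hM : M.PosSemidef) {c : ℝ}
    (hc : 0 ≤ c) : ((c : ℂ) • M).PosSemidef :=
  hM.smul (by exact_mod_cast hc)

/-- Flattening an iterated sum needs absolute convergence. On the diagonal the terms are
nonnegative, and off the diagonal they are dominated by the mean of two diagonal entries. -/
theorem hasSum_sigma_of_posSemidef {J ι : Type} {K : J → Type} {f : ∀ j, K j → Matrix ι ι ℂ}
    {g : J → Matrix ι ι ℂ} {M : Matrix ι ι ℂ} (hf : ∀ j k, (f j k).PosSemidef)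
    (h1 : ∀ j x y, HasSum (fun k => f j k x y) (g j x y))
    (h2 : ∀ x y, HasSum (fun j => g j x y) (M x y)) (x y : ι) :
    HasSum (fun z : Σ j, K j => f z.1 z.2 x y) (M x y) := by
  have hd (x : ι) : Summable fun z : Σ j, K j => (f z.1 z.2 x x).re := by
    rw [summable_sigma_of_nonneg fun z => (hf _ _).re_diag_nonneg x]
    have h3 (j) := Complex.hasSum_re (h1 j x x)
    refine ⟨fun j => (h3 j).summable, ?_⟩
    simpa only [(h3 _).tsum_eq] using (Complex.hasSum_re (h2 x x)).summable
  have hs : Summable fun z : Σ j, K j => f z.1 z.2 x y :=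
    Summable.of_norm_bounded (((hd x).add (hd y)).div_const 2)
      fun z => norm_le_half_diag (hf z.1 z.2) x y
  have := hs.hasSum.sigma fun j => h1 j x y
  rw [(h2 x y).unique this]
  exact hs.hasSum

/-! ### Traces, and countable additivity of positive maps -/

theorem TraceClass.hasSum_diag {ι : Type} (T : TraceClass ι) :
    HasSum (fun x => (T.1 x x).re) (tr T).re :=
  Complex.hasSum_re (TraceClass.summable_diag T.2).hasSum

theorem norm_le_tr {ι : Type} {T : TraceClass ι} (hT : T.1.PosSemidef) (x y : ι) :
    ‖T.1 x y‖ ≤ (tr T).re := by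
  have h (x) := le_hasSum (TraceClass.hasSum_diag T) x fun i _ => hT.re_diag_nonneg i
  linarith [norm_le_half_diag hT x y, h x, h y]

theorem hasSum_tr {J ι : Type} {T : J → TraceClass ι} {S : TraceClass ι}
    (hT : ∀ j, (T j).1.PosSemidef) (h : ∀ x y, HasSum (fun j => (T j).1 x y) (S.1 x y)) :
    HasSum (fun j => (tr (T j)).re) (tr S).re :=
  hasSum_comm_of_nonneg (fun j x => (hT j).re_diag_nonneg x)
    (fun x => Complex.hasSum_re (h x x)) (TraceClass.hasSum_diag S)
    fun j => TraceClass.hasSum_diag (T j)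

theorem mem_traceClass_of_hasSum {ι : Type} {M : Matrix ι ι ℂ} (hM : M.PosSemidef) {a : ℝ}
    (h : HasSum (fun x => (M x x).re) a) : M ∈ TraceClass ι := by
  refine Submodule.subset_span ⟨hM, ?_⟩
  simpa only [Complex.ofRealCLM_apply, hM.ofReal_re_diag] using
    (Complex.ofRealCLM.summable h.summable)

theorem tr_eq_of_hasSum {ι : Type} {T : TraceClass ι} (hT : T.1.PosSemidef) {a : ℝ}
    (h : HasSum (fun x => (T.1 x x).re) a) : tr T = a := by
  refine HasSum.tsum_eq ?_
  simpa only [hT.ofReal_re_diag] using Complex.hasSum_ofReal.2 h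

theorem coe_sub_sum_apply {J ι : Type} (S : TraceClass ι) (T : J → TraceClass ι) (F : Finset J)
    (x y : ι) : (S - ∑ j ∈ F, T j).1 x y = S.1 x y - ∑ j ∈ F, (T j).1 x y := by
  simp [Matrix.sum_apply]

/-- A positive trace-preserving map is countably additive for entrywise sums of positive
operators. -/
theorem hasSum_map_of_posSemidef {J ι κ : Type} {Φ : TraceClass ι →ₗ[ℂ] TraceClass κ}
    (hpos : ∀ T : TraceClass ι, T.1.PosSemidef → (Φ T).1.PosSemidef)
    (htr : ∀ T, tr (Φ T) = tr T) {T : J → TraceClass ι} {S : TraceClass ι}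
    (hT : ∀ j, (T j).1.PosSemidef) (h : ∀ x y, HasSum (fun j => (T j).1 x y) (S.1 x y))
    (x y : κ) : HasSum (fun j => (Φ (T j)).1 x y) ((Φ S).1 x y) := by
  classical
  -- The remainder is the entrywise sum of the `T j` with `j ∉ F`.
  have hR (F : Finset J) : (S - ∑ j ∈ F, T j).1.PosSemidef := by
    refine posSemidef_of_hasSum (f := fun j => if j ∈ F then 0 else (T j).1) (fun j => ?_)
      fun x y => ?_
    · split_ifs
      exacts [Matrix.PosSemidef.zero, hT j]
    · have h1 : HasSum (fun j => if j ∈ F then (T j).1 x y else 0) (∑ j ∈ F, (T j).1 x y) := by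
        rw [← Finset.sum_congr rfl fun j (hj : j ∈ F) => if_pos hj]
        exact hasSum_sum_of_ne_finset_zero fun j hj => if_neg hj
      have h2 := (h x y).sub h1
      rw [← coe_sub_sum_apply] at h2
      refine h2.congr_fun fun j => ?_
      split_ifs <;> simp
  have hlim : Filter.Tendsto (fun F : Finset J => (tr S).re - ∑ j ∈ F, (tr (T j)).re)
      Filter.atTop (nhds 0) := by
    simpa using (hasSum_tr hT h).const_sub (tr S).re
  have htr' (F : Finset J) : (tr (S - ∑ j ∈ F, T j)).re = (tr S).re - ∑ j ∈ F, (tr (T j)).re := by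
    refine (TraceClass.hasSum_diag _).unique ?_
    simpa only [coe_sub_sum_apply, Complex.sub_re, Complex.re_sum] using
      (TraceClass.hasSum_diag S).sub
        (hasSum_sum fun j (_ : j ∈ F) => TraceClass.hasSum_diag (T j))
  rw [HasSum, tendsto_iff_norm_sub_tendsto_zero]
  refine squeeze_zero (fun _ => norm_nonneg _) (fun F => ?_) hlim
  -- An entry of the image of the remainder is at most its trace, which is a tail of the trace
  -- series; no continuity of `Φ` is needed.
  have h2 := norm_le_tr (hpos _ (hR F)) x y
  rw [htr, htr', map_sub, map_sum, coe_sub_sum_apply, norm_sub_rev] at h2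
  exact h2

/-! ### Operators on `ℓ²` and their matrix entries -/

/-- The Hilbert space `ℓ²(ι)`. -/
abbrev Hilb (ι : Type) : Type := lp (fun _ : ι => ℂ) 2

theorem inner_ket_left {ι : Type} (i : ι) (x : Hilb ι) : inner ℂ (ket i) x = x i := by
  classical
  convert lp.inner_single_left (𝕜 := ℂ) (G := fun _ : ι => ℂ) i 1 x using 1
  · unfold ket
    congr!
  · simp

theorem inner_ket_right {ι : Type} (i : ι) (x : Hilb ι) : inner ℂ x (ket i) = star (x i) := by
  rw [← inner_conj_symm, inner_ket_left]
  rfl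

theorem norm_ket {ι : Type} (i : ι) : ‖(ket i : Hilb ι)‖ = 1 := by
  classical
  unfold ket
  rw [lp.norm_single (by norm_num)]
  simp

theorem hasSum_ket {ι : Type} (x : Hilb ι) : HasSum (fun i => x i • (ket i : Hilb ι)) x := by
  classical
  convert lp.hasSum_single (E := fun _ : ι => ℂ) (p := 2) (by norm_num) x using 2 with i
  unfold ket
  rw [← lp.single_smul]
  simp

theorem hasSum_inner_apply {ι : Type} (x y : Hilb ι) :
    HasSum (fun i => star (x i) * y i) (inner ℂ x y) := by
  simpa [mul_comm] using lp.hasSum_inner (𝕜 := ℂ) x y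

theorem hasSum_norm_sq {ι : Type} (x : Hilb ι) : HasSum (fun i => ‖x i‖ ^ 2) (‖x‖ ^ 2) := by
  have h := Complex.hasSum_re (hasSum_inner_apply x x)
  rw [inner_self_eq_norm_sq_to_K] at h
  convert h using 1
  · ext i
    rw [mul_comm, Complex.star_def, Complex.mul_conj, Complex.ofReal_re, Complex.normSq_eq_norm_sq]
  · norm_cast

theorem clm_ext_ket {ι : Type} {E : Type} [NormedAddCommGroup E] [NormedSpace ℂ E]
    {A B : Hilb ι →L[ℂ] E} (h : ∀ i, A (ket i) = B (ket i)) : A = B := by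
  ext x
  refine ((hasSum_ket x).mapL A).unique ?_
  simpa [h] using (hasSum_ket x).mapL B

theorem entry_eq_apply {ι : Type} (A : Hilb ι →L[ℂ] Hilb ι) (i j : ι) :
    entry A i j = A (ket j) i := inner_ket_left _ _

theorem op_ext {ι : Type} {A B : Hilb ι →L[ℂ] Hilb ι} (h : ∀ i j, entry A i j = entry B i j) :
    A = B := by
  refine clm_ext_ket fun j => ?_
  ext i
  rw [← entry_eq_apply, ← entry_eq_apply, h]

theorem entry_op {ι : Type} (T : TraceClass ι) (i j : ι) : entry (TraceClass.op T) i j = T.1 i j :=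
  (TraceClass.exists_operator T).choose_spec i j

theorem op_isPositive {ι : Type} {T : TraceClass ι} (hT : T.1.PosSemidef) :
    (TraceClass.op T).IsPositive := by
  have hsym : ∀ i j, inner ℂ (TraceClass.op T (ket i)) (ket j) = entry (TraceClass.op T) i j := by
    intro i j
    rw [inner_ket_right, ← entry_eq_apply, entry_op, entry_op]
    exact hT.1.apply i j
  have hsa : (TraceClass.op T).adjoint = TraceClass.op T := by
    refine op_ext fun i j => ?_
    rw [← hsym, entry, ContinuousLinearMap.adjoint_inner_right]
  refine ⟨?_, fun x => ?_⟩
  · rw [← ContinuousLinearMap.isSelfAdjoint_iff_isSymmetric]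
    exact hsa
  · have hc : Continuous fun y : Hilb ι => (TraceClass.op T).reApplyInnerSelf y :=
      ContinuousLinearMap.reApplyInnerSelf_continuous _
    -- Matrix positivity speaks of finitely supported vectors; the truncations of `x` converge to
    -- `x` and the quadratic form is continuous.
    refine ge_of_tendsto' ((hc.tendsto x).comp (hasSum_ket x)) fun F => ?_
    have h1 : inner ℂ ((TraceClass.op T) (∑ i ∈ F, x i • ket i)) (∑ i ∈ F, x i • ket i) =
        ∑ i ∈ F, ∑ j ∈ F, star (x i) * T.1 i j * x j := by
      simp only [map_sum, map_smul, sum_inner, inner_sum, inner_smul_left, inner_smul_right, hsym,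
        entry_op, Finset.mul_sum]
      rw [Finset.sum_comm]
      refine Finset.sum_congr rfl fun i _ => Finset.sum_congr rfl fun j _ => ?_
      simp only [Complex.star_def]
      ring
    have h2 := ((hT.submatrix (Subtype.val : F → ι)).dotProduct_mulVec_nonneg fun i : F => x i)
    have h3 : star (fun i : F => x i) ⬝ᵥ (T.1.submatrix (Subtype.val : F → ι) Subtype.val).mulVec
        (fun i : F => x i) = ∑ i ∈ F, ∑ j ∈ F, star (x i) * T.1 i j * x j := by
      simp only [← Finset.sum_coe_sort F]
      simp [dotProduct, Matrix.mulVec, Finset.mul_sum, mul_assoc]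
    simp only [Function.comp_apply, ContinuousLinearMap.reApplyInnerSelf_apply]
    rw [h1, ← h3]
    exact (Complex.nonneg_iff.1 h2).1

theorem opSqrt_isPositive {H : Type} [NormedAddCommGroup H] [InnerProductSpace ℂ H]
    [CompleteSpace H] (A : H →L[ℂ] H) : (opSqrt A).IsPositive :=
  (ContinuousLinearMap.nonneg_iff_isPositive _).1 (CFC.sqrt_nonneg A)

theorem opSqrt_mul_self {H : Type} [NormedAddCommGroup H] [InnerProductSpace ℂ H]
    [CompleteSpace H] {A : H →L[ℂ] H} (hA : A.IsPositive) : opSqrt A * opSqrt A = A :=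
  CFC.sqrt_mul_sqrt_self A ((ContinuousLinearMap.nonneg_iff_isPositive _).2 hA)

theorem inner_opSqrt {H : Type} [NormedAddCommGroup H] [InnerProductSpace ℂ H]
    [CompleteSpace H] (A : H →L[ℂ] H) (x y : H) :
    inner ℂ (opSqrt A x) y = inner ℂ x (opSqrt A y) :=
  (opSqrt_isPositive A).isSymmetric x y

theorem inner_opSqrt_opSqrt {H : Type} [NormedAddCommGroup H] [InnerProductSpace ℂ H]
    [CompleteSpace H] {A : H →L[ℂ] H} (hA : A.IsPositive) (x y : H) :
    inner ℂ (opSqrt A x) (opSqrt A y) = inner ℂ x (A y) := by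
  rw [inner_opSqrt]
  congr 1
  exact congrArg (fun B : H →L[ℂ] H => B y) (opSqrt_mul_self hA)

/-- A positive trace-class operator is a sum of rank-one operators `|v⟩⟨v|`, for instance with the
columns `v` of its square root. -/
theorem hasSum_opSqrt_columns {ι : Type} {T : TraceClass ι} (hT : T.1.PosSemidef) (x y : ι) :
    HasSum (fun k => opSqrt (TraceClass.op T) (ket k) x *
      star (opSqrt (TraceClass.op T) (ket k) y)) (T.1 x y) := by
  -- Parseval's identity for `⟨√T eₓ, √T e_y⟩ = T x y`; self-adjointness then moves each root onto
  -- the summation vector.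
  have h := hasSum_inner_apply (opSqrt (TraceClass.op T) (ket x)) (opSqrt (TraceClass.op T) (ket y))
  rw [inner_opSqrt_opSqrt (op_isPositive hT), ← entry, entry_op] at h
  convert h using 2 with k
  rw [← inner_ket_left k, ← inner_ket_left k, ← inner_opSqrt, ← inner_opSqrt, inner_ket_right,
    inner_ket_right, star_star]

/-! ### Positivity of channels -/

theorem IsCP.posSemidef_map {ι κ : Type} {Φ : TraceClass ι →ₗ[ℂ] TraceClass κ} (hΦ : IsCP Φ)
    {T : TraceClass ι} (hT : T.1.PosSemidef) : (Φ T).1.PosSemidef :=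
  (hΦ 1 (fun _ _ => T) (hT.submatrix fun u : Fin 1 × ι => u.2)).submatrix fun i => (0, i)

theorem Channel.posSemidef_map {ι κ : Type} (N : Channel ι κ) {T : TraceClass ι}
    (hT : T.1.PosSemidef) : (N.toLin T).1.PosSemidef :=
  N.cp.posSemidef_map hT

theorem tr_reindex {ι κ : Type} (e : ι ≃ κ) (T : TraceClass ι) :
    tr (TraceClass.reindex e T) = tr T :=
  e.symm.tsum_eq fun i => T.1 i i

theorem Channel.tr_ampliate {ι κ L : Type} (N : Channel ι κ) (T : TraceClass (L × ι)) :
    tr (N.ampliate L T) = tr T := by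
  have h1 := (TraceClass.summable_diag (N.ampliate L T).2).tsum_prod
  have h2 := (TraceClass.summable_diag T.2).tsum_prod
  unfold tr
  rw [h1, h2]
  exact tsum_congr fun l => N.tp (TraceClass.block T l l)

/-- `Channel.onShares` as a linear map. -/
def Channel.onSharesLin {P : Type} {I O : P → Type} (N : Channel (∀ p, I p) (∀ p, O p))
    (Q : P → Type) : TraceClass (∀ p, Q p × I p) →ₗ[ℂ] TraceClass (∀ p, Q p × O p) where
  toFun := N.onShares Q
  map_add' S T := by
    ext x y
    have h (l m) : TraceClass.block (TraceClass.reindex (pairEquiv Q I) (S + T)) l m =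
      TraceClass.block (TraceClass.reindex (pairEquiv Q I) S) l m +
        TraceClass.block (TraceClass.reindex (pairEquiv Q I) T) l m := rfl
    change (N.toLin (TraceClass.block (TraceClass.reindex (pairEquiv Q I) (S + T)) _ _)).1 _ _ = _
    rw [h, map_add]
    rfl
  map_smul' a S := by
    ext x y
    have h (l m) : TraceClass.block (TraceClass.reindex (pairEquiv Q I) (a • S)) l m =
      a • TraceClass.block (TraceClass.reindex (pairEquiv Q I) S) l m := rfl
    change (N.toLin (TraceClass.block (TraceClass.reindex (pairEquiv Q I) (a • S)) _ _)).1 _ _ = _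
    rw [h, map_smul]
    rfl

theorem Channel.posSemidef_onShares {P : Type} {I O : P → Type}
    (N : Channel (∀ p, I p) (∀ p, O p)) (Q : P → Type) {T : TraceClass (∀ p, Q p × I p)}
    (hT : T.1.PosSemidef) : (N.onSharesLin Q T).1.PosSemidef :=
  (N.cp.posSemidef_ampliate (TraceClass.reindex (pairEquiv Q I) T)
    (hT.submatrix (pairEquiv Q I).symm)).submatrix _

theorem Channel.tr_onShares {P : Type} {I O : P → Type}
    (N : Channel (∀ p, I p) (∀ p, O p)) (Q : P → Type) (T : TraceClass (∀ p, Q p × I p)) :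
    tr (N.onSharesLin Q T) = tr T := by
  change tr (TraceClass.reindex _ _) = _
  rw [tr_reindex, Channel.tr_ampliate, tr_reindex]

/-! ### The cone of separable operators -/

section Separable

variable {P : Type} [Fintype P] {X : P → Type}

/-- The matrix of the product operator `w ⨂ₚ |ψₚ⟩⟨ψₚ|`. -/
def productMatrix (w : ℝ) (ψ : ∀ p, X p → ℂ) : Matrix (∀ p, X p) (∀ p, X p) ℂ :=
  Matrix.of fun x y => (w : ℂ) * ∏ p, (ψ p (x p) * star (ψ p (y p)))

theorem posSemidef_productMatrix {w : ℝ} (hw : 0 ≤ w) (ψ : ∀ p, X p → ℂ) :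
    (productMatrix w ψ).PosSemidef := by
  convert posSemidef_ofReal_smul (posSemidef_rankOne fun x : ∀ p, X p => ∏ p, ψ p (x p)) hw using 1
  ext x y
  simp [productMatrix, Finset.prod_mul_distrib]

theorem re_diag_productMatrix (w : ℝ) (ψ : ∀ p, X p → ℂ) (x : ∀ p, X p) :
    (productMatrix w ψ x x).re = w * ∏ p, ‖ψ p (x p)‖ ^ 2 := by
  have h (p) : ψ p (x p) * star (ψ p (x p)) = ((‖ψ p (x p)‖ ^ 2 : ℝ) : ℂ) := by
    rw [Complex.star_def, Complex.mul_conj, Complex.normSq_eq_norm_sq]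
  simp only [productMatrix, Matrix.of_apply, h]
  rw [← Complex.ofReal_prod, ← Complex.ofReal_mul, Complex.ofReal_re]

theorem hasSum_diag_productMatrix (w : ℝ) {ψ : ∀ p, X p → ℂ} {a : P → ℝ}
    (h : ∀ p, HasSum (fun x => ‖ψ p x‖ ^ 2) (a p)) :
    HasSum (fun x => (productMatrix w ψ x x).re) (w * ∏ p, a p) := by
  simp only [re_diag_productMatrix]
  exact (hasSum_pi_prod_real (fun _ _ => by positivity) h).mul_left w

/-- The product operator `w ⨂ₚ |ψₚ⟩⟨ψₚ|`. -/
def productOp {w : ℝ} (hw : 0 ≤ w) {ψ : ∀ p, X p → ℂ}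
    (h : ∀ p, Summable fun x => ‖ψ p x‖ ^ 2) : TraceClass (∀ p, X p) :=
  ⟨productMatrix w ψ, mem_traceClass_of_hasSum (posSemidef_productMatrix hw ψ)
    (hasSum_diag_productMatrix w fun p => (h p).hasSum)⟩

/-- A state which is a countable sum of positive product operators is fully separable. -/
theorem isFullySeparable_of_hasSum {ρ : TraceClass (∀ p, X p)} (hρ : tr ρ = 1) {J : Type}
    [Countable J] {w : J → ℝ} {ψ : J → ∀ p, X p → ℂ} (hw : ∀ j, 0 ≤ w j)
    (hψ : ∀ j p, Summable fun x => ‖ψ j p x‖ ^ 2)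
    (h : ∀ x y, HasSum (fun j => productMatrix (w j) (ψ j) x y) (ρ.1 x y)) :
    IsFullySeparable ρ := by
  let a (j : J) (p : P) : ℝ := ∑' x, ‖ψ j p x‖ ^ 2
  have ha (j p) : HasSum (fun x => ‖ψ j p x‖ ^ 2) (a j p) := (hψ j p).hasSum
  have ha0 (j p) : 0 ≤ a j p := tsum_nonneg fun _ => by positivity
  have hz (j p) (h0 : a j p = 0) (x) : ψ j p x = 0 := by
    have h1 := ha j p
    rw [h0, hasSum_zero_iff_of_nonneg fun _ => by positivity] at h1
    simpa using congrFun h1 x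
  have hw1 : HasSum (fun j => w j * ∏ p, a j p) 1 := by
    have := hasSum_comm_of_nonneg
      (fun j x => (posSemidef_productMatrix (hw j) (ψ j)).re_diag_nonneg x)
      (fun x => Complex.hasSum_re (h x x)) (TraceClass.hasSum_diag ρ)
      fun j => hasSum_diag_productMatrix (w j) (ha j)
    simpa [hρ] using this
  -- A term with a vanishing local vector cannot be normalized, but it contributes nothing and is
  -- dropped. The squared norms of the others are absorbed into the weights.
  let s : Set J := {j | ∀ p, a j p ≠ 0}
  refine ⟨s, inferInstance, fun j => w j * ∏ p, a j p,
    fun j p x => ((√(a j p))⁻¹ : ℝ) * ψ j p x, fun j => mul_nonneg (hw j)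
      (Finset.prod_nonneg fun p _ => ha0 j p), ?_, fun j p => ?_, fun x y => ?_⟩
  · refine (hasSum_subtype_iff_of_support_subset (s := s) fun j hj p hp => ?_).2 hw1
    refine hj ?_
    simp [Finset.prod_eq_zero (Finset.mem_univ p) hp]
  · have h1 := (ha j p).mul_left (a j p)⁻¹
    rw [inv_mul_cancel₀ (j.2 p)] at h1
    refine h1.congr_fun fun x => ?_
    rw [norm_mul, mul_pow, Complex.norm_real, Real.norm_eq_abs, sq_abs, inv_pow,
      Real.sq_sqrt (ha0 _ _)]
  · have h1 : Function.support (fun j => productMatrix (w j) (ψ j) x y) ⊆ s := by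
      intro j hj p hp
      refine hj ?_
      simp [productMatrix, Finset.prod_eq_zero (Finset.mem_univ p), hz j p hp]
    refine ((hasSum_subtype_iff_of_support_subset h1).2 (h x y)).congr_fun fun j => ?_
    simp only [productMatrix, Matrix.of_apply, Function.comp_apply, Complex.ofReal_mul, mul_assoc,
      Complex.ofReal_prod]
    rw [← Finset.prod_mul_distrib]
    congr 1
    refine Finset.prod_congr rfl fun p _ => ?_
    have h2 : (a j p : ℂ) * ((√(a j p))⁻¹ : ℝ) * ((√(a j p))⁻¹ : ℝ) = 1 := by
      rw [← Complex.ofReal_mul, ← Complex.ofReal_mul, mul_assoc, ← mul_inv,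
        Real.mul_self_sqrt (ha0 _ _), mul_inv_cancel₀ (j.2 p), Complex.ofReal_one]
    simp only [star_mul', Complex.star_def, Complex.conj_ofReal]
    linear_combination (ψ j p (x p) * (starRingEnd ℂ) (ψ j p (y p))) * h2

theorem IsFullySeparable.posSemidef {ρ : TraceClass (∀ p, X p)} (hρ : IsFullySeparable ρ) :
    ρ.1.PosSemidef := by
  obtain ⟨J, _, w, ψ, hw, -, -, h⟩ := hρ
  exact posSemidef_of_hasSum (fun j => posSemidef_productMatrix (hw j) (ψ j)) h

theorem IsFullySeparable.hasSum_diag {ρ : TraceClass (∀ p, X p)} (hρ : IsFullySeparable ρ) :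
    HasSum (fun x => (ρ.1 x x).re) 1 := by
  obtain ⟨J, _, w, ψ, hw, hw1, hψ, h⟩ := hρ
  have h1 (j) : HasSum (fun x => (productMatrix (w j) (ψ j) x x).re) (w j) := by
    simpa using hasSum_diag_productMatrix (w j) (hψ j)
  have h2 (j x) := (posSemidef_productMatrix (hw j) (ψ j)).re_diag_nonneg x
  exact hasSum_comm_of_nonneg (fun x j => h2 j x) h1 hw1 fun x => Complex.hasSum_re (h x x)

theorem IsFullySeparable.tr_eq {ρ : TraceClass (∀ p, X p)} (hρ : IsFullySeparable ρ) :
    tr ρ = 1 := by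
  rw [tr_eq_of_hasSum hρ.posSemidef hρ.hasSum_diag, Complex.ofReal_one]

/-- Countable convex combinations of fully separable states are fully separable states. -/
theorem exists_isFullySeparable_hasSum {J : Type} [Countable J] {w : J → ℝ} (hw : ∀ j, 0 ≤ w j)
    (hw1 : HasSum w 1) {τ : J → TraceClass (∀ p, X p)} (hτ : ∀ j, IsFullySeparable (τ j)) :
    ∃ σ : TraceClass (∀ p, X p), IsFullySeparable σ ∧
      ∀ x y, HasSum (fun j => (w j : ℂ) * (τ j).1 x y) (σ.1 x y) := by
  have hn (j x y) : ‖(w j : ℂ) * (τ j).1 x y‖ ≤ w j := by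
    have h := norm_le_tr (hτ j).posSemidef x y
    rw [(hτ j).tr_eq, Complex.one_re] at h
    rw [norm_mul, Complex.norm_real, Real.norm_of_nonneg (hw j)]
    exact mul_le_of_le_one_right (hw j) h
  let M : Matrix (∀ p, X p) (∀ p, X p) ℂ := Matrix.of fun x y => ∑' j, (w j : ℂ) * (τ j).1 x y
  have hM (x y) : HasSum (fun j => (w j : ℂ) * (τ j).1 x y) (M x y) :=
    (Summable.of_norm_bounded hw1.summable fun j => hn j x y).hasSum
  have hp (j) := posSemidef_ofReal_smul (hτ j).posSemidef (hw j)
  have hMp : M.PosSemidef := posSemidef_of_hasSum hp hM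
  have hMd : HasSum (fun x => (M x x).re) 1 := by
    refine hasSum_comm_of_nonneg (fun x j => (hp j).re_diag_nonneg x) (fun j => ?_) hw1
      fun x => Complex.hasSum_re (hM x x)
    simpa using (hτ j).hasSum_diag.mul_left (w j)
  let σ : TraceClass (∀ p, X p) := ⟨M, mem_traceClass_of_hasSum hMp hMd⟩
  have hσ : tr σ = 1 := by rw [tr_eq_of_hasSum (T := σ) hMp hMd, Complex.ofReal_one]
  refine ⟨σ, ?_, hM⟩
  choose K hK v ψ hv _ hψ h using hτ
  refine isFullySeparable_of_hasSum (J := Σ j, K j) (w := fun z => w z.1 * v z.1 z.2)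
    (ψ := fun z => ψ z.1 z.2) hσ (fun z => mul_nonneg (hw _) (hv _ _))
    (fun z p => (hψ _ _ p).summable) fun x y => ?_
  refine hasSum_sigma_of_posSemidef (f := fun j k => productMatrix (w j * v j k) (ψ j k))
    (g := fun j => (w j : ℂ) • (τ j).1)
    (fun j k => posSemidef_productMatrix (mul_nonneg (hw j) (hv j k)) (ψ j k)) (fun j x y => ?_)
    (fun x y => hM x y) x y
  refine ((h j x y).mul_left (w j : ℂ)).congr_fun fun k => ?_
  simp [productMatrix, mul_assoc]

end Separable

/-! ### LOCC channels and full separability -/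

theorem rankOne_mem_traceClass {ι : Type} {ψ : ι → ℂ} (h : Summable fun x => ‖ψ x‖ ^ 2) :
    (Matrix.of fun x y => ψ x * star (ψ y)) ∈ TraceClass ι := by
  refine mem_traceClass_of_hasSum (posSemidef_rankOne _) (h.hasSum.congr_fun fun x => ?_)
  rw [Matrix.of_apply, Complex.star_def, Complex.mul_conj, Complex.ofReal_re,
    Complex.normSq_eq_norm_sq]

/-- Multiplying out the column decompositions of the local square roots gives product rank-one
terms, indexed by tuples of basis labels. This replaces Kraus decompositions of the local maps: only
positivity of their outputs is needed. -/
theorem exists_hasSum_columns {P : Type} [Fintype P] {Y : P → Type} {T : ∀ p, TraceClass (Y p)}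
    (hT : ∀ p, (T p).1.PosSemidef) : ∃ u : (∀ p, Y p) → ∀ p, Y p → ℂ,
      (∀ m p, Summable fun x => ‖u m p x‖ ^ 2) ∧
      ∀ x y, HasSum (fun m => productMatrix 1 (u m) x y) (∏ p, (T p).1 (x p) (y p)) := by
  refine ⟨fun m p => opSqrt (TraceClass.op (T p)) (ket (m p)),
    fun m p => (hasSum_norm_sq _).summable, fun x y => ?_⟩
  have hv (p) (x y : Y p) := hasSum_opSqrt_columns (hT p) x y
  have h := hasSum_pi_prod (f := fun p m => opSqrt (TraceClass.op (T p)) (ket m) (x p) *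
    star (opSqrt (TraceClass.op (T p)) (ket m) (y p))) (fun p => ?_) fun p => hv p (x p) (y p)
  · simpa [productMatrix] using h
  · refine Summable.of_norm_bounded (((Complex.hasSum_re (hv p (x p) (x p))).add
      (Complex.hasSum_re (hv p (y p) (y p)))).div_const 2).summable fun m => ?_
    rw [norm_norm]
    exact norm_le_half_diag (posSemidef_rankOne (opSqrt (TraceClass.op (T p)) (ket m))) (x p) (y p)

theorem IsLOCC.exists_hasSum {P : Type} [Fintype P] {X Y : P → Type} [∀ p, Countable (Y p)]
    {Λ : Channel (∀ p, X p) (∀ p, Y p)} (hΛ : IsLOCC Λ) {ψ : ∀ p, X p → ℂ}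
    (hψ : ∀ p, Summable fun x => ‖ψ p x‖ ^ 2) {S : TraceClass (∀ p, X p)}
    (hS : S.1 = productMatrix 1 ψ) :
    ∃ (K : Type) (_ : Countable K) (u : K → ∀ p, Y p → ℂ),
      (∀ k p, Summable fun x => ‖u k p x‖ ^ 2) ∧
      ∀ x y, HasSum (fun k => productMatrix 1 (u k) x y) ((Λ.toLin S).1 x y) := by
  obtain ⟨K, _, E, hE, hΛE⟩ := hΛ
  let T (p) : TraceClass (X p) := ⟨_, rankOne_mem_traceClass (hψ p)⟩
  have hST (x y : ∀ p, X p) : S.1 x y = ∏ p, (T p).1 (x p) (y p) := by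
    simp [hS, T, productMatrix]
  have h1 (k) := exists_hasSum_columns fun p =>
    (hE p k).1.posSemidef_map (T := T p) (posSemidef_rankOne (ψ p))
  choose u hu h using h1
  -- An index is an LOCC outcome with a tuple of basis labels; there are countably many because `P`
  -- is finite and the output systems are countable.
  refine ⟨Σ _ : K, ∀ p, Y p, inferInstance, fun z => u z.1 z.2, fun z => hu z.1 z.2,
    fun x y => ?_⟩
  exact hasSum_sigma_of_posSemidef (f := fun k m => productMatrix 1 (u k m))
    (g := fun k => Matrix.of fun x y => ∏ p, (E p k (T p)).1 (x p) (y p))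
    (fun k m => posSemidef_productMatrix zero_le_one (u k m)) h (hΛE T S hST) x y

/-- LOCC channels map fully separable states to fully separable states. -/
theorem IsLOCC.isFullySeparable {P : Type} [Fintype P] {X Y : P → Type} [∀ p, Countable (Y p)]
    {Λ : Channel (∀ p, X p) (∀ p, Y p)} (hΛ : IsLOCC Λ) {σ : TraceClass (∀ p, X p)}
    (hσ : IsFullySeparable σ) : IsFullySeparable (Λ.toLin σ) := by
  have htr : tr (Λ.toLin σ) = 1 := (Λ.tp σ).trans hσ.tr_eq
  obtain ⟨J, _, w, ψ, hw, hw1, hψ, h⟩ := hσ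
  let S (j) : TraceClass (∀ p, X p) := productOp zero_le_one fun p => (hψ j p).summable
  -- `IsLOCC` prescribes `Λ` on product operators only; countable additivity carries this to the
  -- mixture `σ`.
  have h1 (x y) : HasSum (fun j => (Λ.toLin ((w j : ℂ) • S j)).1 x y) ((Λ.toLin σ).1 x y) := by
    refine hasSum_map_of_posSemidef (fun _ => Λ.posSemidef_map) Λ.tp (fun j => ?_) (fun x y => ?_)
      x y
    · exact posSemidef_ofReal_smul (posSemidef_productMatrix zero_le_one (ψ j)) (hw j)
    · refine (h x y).congr_fun fun j => ?_
      change (w j : ℂ) * (((1 : ℝ) : ℂ) * _) = _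
      rw [Complex.ofReal_one, one_mul]
  choose K hK u hu h2 using fun j => hΛ.exists_hasSum (fun p => (hψ j p).summable) (S := S j) rfl
  refine isFullySeparable_of_hasSum (J := Σ j : J, K j) (w := fun z => w z.1)
    (ψ := fun z => u z.1 z.2) htr (fun z => hw z.1) (fun z => hu z.1 z.2) fun x y => ?_
  refine hasSum_sigma_of_posSemidef (f := fun j k => productMatrix (w j) (u j k))
    (g := fun j => (Λ.toLin ((w j : ℂ) • S j)).1)
    (fun j k => posSemidef_productMatrix (hw j) (u j k)) (fun j x y => ?_) h1 x y
  rw [map_smul]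
  refine ((h2 j x y).mul_left (w j : ℂ)).congr_fun fun k => ?_
  simp [productMatrix]

/-! ### Max-relative entropy of entanglement and product vectors -/

theorem maxEntanglement_le {P : Type} [Fintype P] {X : P → Type} {ρ σ : TraceClass (∀ p, X p)}
    (hσ : IsFullySeparable σ) {l : ℝ}
    (h : ((((2 : ℝ) ^ l : ℝ) : ℂ) • σ.1 - ρ.1).PosSemidef) : maxEntanglement ρ ≤ l :=
  iInf₂_le_of_le σ hσ (iInf₂_le l h)

/-- The infimum need not be attained. A strict bound yields a witness with a smaller exponent `l'`,
which may be raised to `l` because `σ` is positive. -/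
theorem exists_of_maxEntanglement_lt {P : Type} [Fintype P] {X : P → Type}
    {ρ : TraceClass (∀ p, X p)} {l : ℝ} (h : maxEntanglement ρ < l) :
    ∃ σ, IsFullySeparable σ ∧ ((((2 : ℝ) ^ l : ℝ) : ℂ) • σ.1 - ρ.1).PosSemidef := by
  simp only [maxEntanglement, maxRelEntropy, iInf_lt_iff] at h
  obtain ⟨σ, hσ, l', h', hl⟩ := h
  refine ⟨σ, hσ, ?_⟩
  have hl' : (2 : ℝ) ^ l' ≤ (2 : ℝ) ^ l :=
    Real.rpow_le_rpow_of_exponent_le one_le_two (EReal.coe_lt_coe_iff.1 hl).le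
  convert h'.add (posSemidef_ofReal_smul hσ.posSemidef (sub_nonneg.2 hl')) using 1
  ext x y
  simp
  ring

/-- Product pure states are fully separable. -/
theorem isFullySeparable_of_eq_productMatrix {P : Type} [Fintype P] {X : P → Type}
    {ρ : TraceClass (∀ p, X p)} {ψ : ∀ p, X p → ℂ}
    (hψ : ∀ p, HasSum (fun x => ‖ψ p x‖ ^ 2) 1) (h : ρ.1 = productMatrix 1 ψ) :
    IsFullySeparable ρ := by
  refine ⟨Unit, inferInstance, fun _ => 1, fun _ => ψ, fun _ => zero_le_one, ?_, fun _ => hψ,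
    fun x y => ?_⟩
  · simp
  · rw [h]
    exact hasSum_unique fun _ : Unit => productMatrix 1 ψ x y

theorem isPure_of_eq_productMatrix {P : Type} [Fintype P] {X : P → Type}
    {ρ : TraceClass (∀ p, X p)} {ψ : ∀ p, X p → ℂ}
    (hψ : ∀ p, HasSum (fun x => ‖ψ p x‖ ^ 2) 1) (h : ρ.1 = productMatrix 1 ψ) : IsPure ρ := by
  refine ⟨fun x => ∏ p, ψ p (x p), ?_, fun x y => ?_⟩
  · simpa [Finset.prod_pow] using hasSum_pi_prod_real (fun _ _ => by positivity) hψ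
  · simp [h, productMatrix, Finset.prod_mul_distrib]

theorem hasSum_norm_sq_prod_unit {X : Type} {v : X × Unit → ℂ} {a : ℝ}
    (h : HasSum (fun x => ‖v x‖ ^ 2) a) : HasSum (fun x => ‖v (x, ())‖ ^ 2) a :=
  (Equiv.prodPUnit X).symm.hasSum_iff.2 h

theorem hasSum_norm_sq_unit_prod {X : Type} {v : Unit × X → ℂ} {a : ℝ}
    (h : HasSum (fun x => ‖v x‖ ^ 2) a) : HasSum (fun x => ‖v ((), x)‖ ^ 2) a :=
  hasSum_norm_sq_prod_unit (v := fun x => v (x.2, x.1)) ((Equiv.prodComm X Unit).hasSum_iff.2 h)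

/-! ### Splitting off the receivers' memories; reduction to pure inputs -/

section Multiplex

variable {𝒜 ℬ 𝒞 : Type}

/-- Forget the reference systems of the receivers. -/
def refProj (Q : 𝒜 ⊕ ℬ ⊕ 𝒞 → Type) :
    ∀ p, Q p → RefSys 𝒞 (fun a => Q (.inl a)) (fun b => Q (.inr (.inl b))) p
  | .inl _ => fun q => q
  | .inr (.inl _) => fun q => q
  | .inr (.inr _) => fun _ => ()

variable {A' : 𝒜 → Type} {B : ℬ → Type}

/-- The amplitudes of the vectors `ψ p` of the receivers, as functions of their reference systems,
and `1` for the other parties. -/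
def receiverAmplitude {Q : 𝒜 ⊕ ℬ ⊕ 𝒞 → Type} (ψ : ∀ p, Q p × InSys 𝒞 A' B p → ℂ) :
    ∀ p, Q p → ℂ
  | .inl _ => fun _ => 1
  | .inr (.inl _) => fun _ => 1
  | .inr (.inr c) => fun q => ψ (.inr (.inr c)) (q, ())

/-- The vectors `ψ p` of the senders, and `1` for the receivers. -/
def senderVector {Q : 𝒜 ⊕ ℬ ⊕ 𝒞 → Type} (ψ : ∀ p, Q p × InSys 𝒞 A' B p → ℂ) :
    ∀ p, RefSys 𝒞 (fun a => Q (.inl a)) (fun b => Q (.inr (.inl b))) p × InSys 𝒞 A' B p → ℂ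
  | .inl a => ψ (.inl a)
  | .inr (.inl b) => ψ (.inr (.inl b))
  | .inr (.inr _) => fun _ => 1

/-- A receiver's channel input is trivial, so its whole vector lives on its reference system and
acts as a scalar factor for the channel. -/
theorem receiverAmplitude_mul_senderVector {Q : 𝒜 ⊕ ℬ ⊕ 𝒞 → Type}
    (ψ : ∀ p, Q p × InSys 𝒞 A' B p → ℂ) (p) (q : Q p) (i : InSys 𝒞 A' B p) :
    receiverAmplitude ψ p q * senderVector ψ p (refProj Q p q, i) = ψ p (q, i) := by
  rcases p with a | b | c
  · exact one_mul _
  · exact one_mul _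
  · exact mul_one _

theorem hasSum_senderVector {Q : 𝒜 ⊕ ℬ ⊕ 𝒞 → Type} {ψ : ∀ p, Q p × InSys 𝒞 A' B p → ℂ}
    (hψ : ∀ p, HasSum (fun x => ‖ψ p x‖ ^ 2) 1) (p) :
    HasSum (fun x => ‖senderVector ψ p x‖ ^ 2) 1 := by
  rcases p with a | b | c
  · exact hψ _
  · exact hψ _
  · change HasSum (fun _ : Unit × Unit => ‖(1 : ℂ)‖ ^ 2) 1
    simpa using hasSum_fintype fun _ : Unit × Unit => (1 : ℝ)

/-- Reattaching a receiver's memory is a tensor product of unit vectors, hence again a unit vector;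
the other parties are unchanged. -/
theorem hasSum_receiverAmplitude_mul {A : 𝒜 → Type} {C : 𝒞 → Type} {Q : 𝒜 ⊕ ℬ ⊕ 𝒞 → Type}
    {ψ : ∀ p, Q p × InSys 𝒞 A' B p → ℂ} (hψ : ∀ p, HasSum (fun x => ‖ψ p x‖ ^ 2) 1)
    {φ : ∀ p, RefSys 𝒞 (fun a => Q (.inl a)) (fun b => Q (.inr (.inl b))) p ×
      OutSys ℬ A C p → ℂ} (hφ : ∀ p, HasSum (fun x => ‖φ p x‖ ^ 2) 1) (p) :
    HasSum (fun x : Q p × OutSys ℬ A C p =>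
      ‖receiverAmplitude ψ p x.1 * φ p (refProj Q p x.1, x.2)‖ ^ 2) 1 := by
  rcases p with a | b | c
  · refine (hφ (.inl a)).congr_fun fun x => ?_
    exact congrArg (‖·‖ ^ 2) (one_mul _)
  · refine (hφ (.inr (.inl b))).congr_fun fun x => ?_
    exact congrArg (‖·‖ ^ 2) (one_mul _)
  · let v : Q (.inr (.inr c)) × Unit → ℂ := ψ (.inr (.inr c))
    let u : Unit × C c → ℂ := φ (.inr (.inr c))
    have h1 := hasSum_norm_sq_prod_unit (v := v) (hψ (.inr (.inr c)))
    have h2 := hasSum_norm_sq_unit_prod (v := u) (hφ (.inr (.inr c)))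
    have h3 := h1.mul h2 (h1.summable.mul_of_nonneg h2.summable (fun _ => by positivity)
      fun _ => by positivity)
    rw [one_mul] at h3
    refine h3.congr_fun fun x => ?_
    exact (congrArg (· ^ 2) (norm_mul (v (x.1, ())) (u ((), x.2)))).trans (mul_pow _ _ 2)

variable [Fintype 𝒜] [Fintype ℬ] [Fintype 𝒞] {A : 𝒜 → Type} {C : 𝒞 → Type}

/-- For a product input, the reference systems of the receivers factor out of the output. -/
theorem onShares_productMatrix (N : MultiplexChannel A' A B C) {Q : 𝒜 ⊕ ℬ ⊕ 𝒞 → Type}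
    {ψ : ∀ p, Q p × InSys 𝒞 A' B p → ℂ} {S : TraceClass (∀ p, Q p × InSys 𝒞 A' B p)}
    (hS : S.1 = productMatrix 1 ψ) {S' : TraceClass (∀ p, RefSys 𝒞 (fun a => Q (.inl a))
      (fun b => Q (.inr (.inl b))) p × InSys 𝒞 A' B p)}
    (hS' : S'.1 = productMatrix 1 (senderVector ψ)) (x y : ∀ p, Q p × OutSys ℬ A C p) :
    (N.onSharesLin Q S).1 x y = (∏ p, receiverAmplitude ψ p (x p).1) *
      (N.onSharesLin _ S').1 (fun p => (refProj Q p (x p).1, (x p).2))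
        (fun p => (refProj Q p (y p).1, (y p).2)) *
      star (∏ p, receiverAmplitude ψ p (y p).1) := by
  -- `N` acts linearly on each block, and a block of `S` is a scalar multiple of one of `S'`.
  have key : TraceClass.block (TraceClass.reindex (pairEquiv Q (InSys 𝒞 A' B)) S)
      (fun p => (x p).1) (fun p => (y p).1) =
      ((∏ p, receiverAmplitude ψ p (x p).1) * star (∏ p, receiverAmplitude ψ p (y p).1)) •
        TraceClass.block (TraceClass.reindex (pairEquiv _ (InSys 𝒞 A' B)) S')
          (fun p => refProj Q p (x p).1) (fun p => refProj Q p (y p).1) := by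
    ext i j
    change S.1 (fun p => ((x p).1, i p)) (fun p => ((y p).1, j p)) = _ *
      S'.1 (fun p => (refProj Q p (x p).1, i p)) (fun p => (refProj Q p (y p).1, j p))
    rw [hS, hS']
    simp only [productMatrix, Matrix.of_apply, Complex.ofReal_one, one_mul,
      ← receiverAmplitude_mul_senderVector ψ, Finset.prod_mul_distrib, star_mul', star_prod]
    ring
  change (N.toLin (TraceClass.block _ (fun p => (x p).1) fun p => (y p).1)).1 _ _ = _
  rw [key, map_smul]
  change _ * _ * _ = _ * (N.toLin (TraceClass.block _ (fun p => refProj Q p (x p).1)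
    fun p => refProj Q p (y p).1)).1 (fun p => (x p).2) (fun p => (y p).2) * _
  rw [mul_right_comm]
  rfl

/-- Without the receivers' memories the input is admissible in `channelMaxEntanglementPure`.
Tensoring both sides of the resulting operator inequality with the memory states keeps it valid and
keeps the dominating state separable. -/
theorem exists_isFullySeparable_of_product (N : MultiplexChannel A' A B C)
    {Q : 𝒜 ⊕ ℬ ⊕ 𝒞 → Type} [∀ p, Countable (Q p)] {l : ℝ} (hl : channelMaxEntanglementPure N < l)
    {ψ : ∀ p, Q p × InSys 𝒞 A' B p → ℂ} (hψ : ∀ p, HasSum (fun x => ‖ψ p x‖ ^ 2) 1)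
    {S : TraceClass (∀ p, Q p × InSys 𝒞 A' B p)} (hS : S.1 = productMatrix 1 ψ) :
    ∃ τ, IsFullySeparable τ ∧
      ((((2 : ℝ) ^ l : ℝ) : ℂ) • τ.1 - (N.onSharesLin Q S).1).PosSemidef := by
  have hψ' := hasSum_senderVector hψ
  let S' := productOp zero_le_one fun p => (hψ' p).summable
  have hlt : maxEntanglement (N.onShares _ S') < l := by
    refine lt_of_le_of_lt ?_ hl
    exact le_iSup₂_of_le _ _ (le_iSup₂_of_le (fun a => inferInstance) (fun b => inferInstance)
      (le_iSup₂_of_le S' ⟨isFullySeparable_of_eq_productMatrix hψ' rfl,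
        isPure_of_eq_productMatrix hψ' rfl⟩ le_rfl))
  obtain ⟨τ', ⟨J, _, w, φ, hw, hw1, hφ, h⟩, hτ'⟩ := exists_of_maxEntanglement_lt hlt
  let χ (j) (p) (x : Q p × OutSys ℬ A C p) : ℂ :=
    receiverAmplitude ψ p x.1 * φ j p (refProj Q p x.1, x.2)
  have hχ (j p) : HasSum (fun x => ‖χ j p x‖ ^ 2) 1 := hasSum_receiverAmplitude_mul hψ (hφ j) p
  obtain ⟨τ, hτ, hs⟩ := exists_isFullySeparable_hasSum hw hw1
    (τ := fun j => productOp zero_le_one fun p => (hχ j p).summable)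
    fun j => isFullySeparable_of_eq_productMatrix (hχ j) rfl
  refine ⟨τ, hτ, ?_⟩
  let r (x : ∀ p, Q p × OutSys ℬ A C p) (p) := (refProj Q p (x p).1, (x p).2)
  have hτe (x y) : τ.1 x y = (∏ p, receiverAmplitude ψ p (x p).1) * τ'.1 (r x) (r y) *
      star (∏ p, receiverAmplitude ψ p (y p).1) := by
    refine (hs x y).unique ((((h (r x) (r y)).mul_left _).mul_right _).congr_fun fun j => ?_)
    simp only [productOp, productMatrix, Matrix.of_apply, χ, r, Complex.ofReal_one, one_mul,
      Finset.prod_mul_distrib, star_mul', star_prod]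
    ring
  -- In coordinates, tensoring with the memories is a pullback along `r` followed by a diagonal
  -- congruence with the amplitudes.
  convert posSemidef_congruence (hτ'.submatrix r) (fun x => ∏ p, receiverAmplitude ψ p (x p).1)
    using 1
  ext x y
  simp only [Matrix.sub_apply, Matrix.smul_apply, hτe, onShares_productMatrix N hS (S' := S') rfl,
    Matrix.submatrix_apply, Matrix.of_apply, smul_eq_mul]
  change _ = _ * (_ - (N.onSharesLin _ S').1 _ _) * _
  ring

/-- A fully separable input is mapped below a multiple of a fully separable state, where
all parties may have reference systems. -/
theorem exists_isFullySeparable_onShares (N : MultiplexChannel A' A B C)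
    {Q : 𝒜 ⊕ ℬ ⊕ 𝒞 → Type} [∀ p, Countable (Q p)] {l : ℝ} (hl : channelMaxEntanglementPure N < l)
    {σ : TraceClass (∀ p, Q p × InSys 𝒞 A' B p)} (hσ : IsFullySeparable σ) :
    ∃ τ, IsFullySeparable τ ∧
      ((((2 : ℝ) ^ l : ℝ) : ℂ) • τ.1 - (N.onSharesLin Q σ).1).PosSemidef := by
  obtain ⟨J, _, w, ψ, hw, hw1, hψ, h⟩ := hσ
  let S (j) : TraceClass (∀ p, Q p × InSys 𝒞 A' B p) :=
    productOp zero_le_one fun p => (hψ j p).summable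
  choose τ hτ hτS using fun j =>
    exists_isFullySeparable_of_product N hl (hψ j) (S := S j) rfl
  -- The exponent `l` is the same for all `j`, so averaging the inequalities with the weights of `σ`
  -- preserves the factor `2 ^ l`.
  obtain ⟨τ', hτ', hs⟩ := exists_isFullySeparable_hasSum hw hw1 hτ
  refine ⟨τ', hτ', ?_⟩
  have h1 (x y) : HasSum (fun j => (N.onSharesLin Q ((w j : ℂ) • S j)).1 x y)
      ((N.onSharesLin Q σ).1 x y) := by
    refine hasSum_map_of_posSemidef (fun _ => N.posSemidef_onShares Q) (N.tr_onShares Q)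
      (fun j => ?_) (fun x y => ?_) x y
    · exact posSemidef_ofReal_smul (posSemidef_productMatrix zero_le_one (ψ j)) (hw j)
    · refine (h x y).congr_fun fun j => ?_
      change (w j : ℂ) * (((1 : ℝ) : ℂ) * _) = _
      rw [Complex.ofReal_one, one_mul]
  refine posSemidef_of_hasSum (fun j => posSemidef_ofReal_smul (hτS j) (hw j)) fun x y => ?_
  refine (((hs x y).mul_left (((2 : ℝ) ^ l : ℝ) : ℂ)).sub (h1 x y)).congr_fun fun j => ?_
  rw [map_smul]
  simp only [Matrix.smul_apply, Matrix.sub_apply, smul_eq_mul, Submodule.coe_smul]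
  ring

/-- The nontrivial bound is quasi-convexity: every real `l` above the pure supremum also bounds
mixtures of product inputs. The other bound is inclusion. -/
theorem channelMaxEntanglement_eq_pure (N : MultiplexChannel A' A B C) :
    channelMaxEntanglement N = channelMaxEntanglementPure N := by
  apply le_antisymm
  · refine iSup₂_le fun L R => iSup₂_le fun hL hR => iSup₂_le fun ψ hψ => ?_
    refine EReal.le_of_forall_lt_iff_le.1 fun l hl => ?_
    have : ∀ p, Countable (RefSys 𝒞 L R p) := by
      rintro (a | b | c)
      exacts [hL a, hR b, inferInstanceAs (Countable Unit)]
    obtain ⟨τ, hτ, h⟩ := exists_isFullySeparable_onShares N hl hψ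
    exact maxEntanglement_le hτ h
  · refine iSup_mono fun L => iSup_mono fun R => iSup_mono fun hL => iSup_mono fun hR =>
      iSup_mono fun ψ => ?_
    exact iSup_mono' fun h => ⟨h.1, le_rfl⟩

end Multiplex

/-! ### Hilbert–Schmidt norms -/

open scoped ENNReal

/-- The square of the Hilbert–Schmidt norm. -/
noncomputable def hilbertSchmidt {ι κ : Type} (A : Hilb ι →L[ℂ] Hilb κ) : ℝ≥0∞ :=
  ∑' i, ENNReal.ofReal (‖A (ket i)‖ ^ 2)

theorem ofReal_norm_sq {ι : Type} (x : Hilb ι) :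
    ENNReal.ofReal (‖x‖ ^ 2) = ∑' i, ENNReal.ofReal (‖x i‖ ^ 2) := by
  rw [← (hasSum_norm_sq x).tsum_eq,
    ENNReal.ofReal_tsum_of_nonneg (fun _ => by positivity) (hasSum_norm_sq x).summable]

theorem adjoint_ket_apply {ι κ : Type} (A : Hilb ι →L[ℂ] Hilb κ) (i : ι) (k : κ) :
    A.adjoint (ket k) i = star (A (ket i) k) := by
  rw [← inner_ket_left, ContinuousLinearMap.adjoint_inner_right, inner_ket_right]

/-- Both sides sum the squared moduli of all matrix entries. With values in `ℝ≥0∞` the order of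
summation is free, without finiteness. -/
theorem hilbertSchmidt_adjoint {ι κ : Type} (A : Hilb ι →L[ℂ] Hilb κ) :
    hilbertSchmidt A.adjoint = hilbertSchmidt A := by
  simp only [hilbertSchmidt, ofReal_norm_sq, adjoint_ket_apply, norm_star]
  exact ENNReal.tsum_comm

theorem hilbertSchmidt_comp_le {ι κ μ : Type} {A : Hilb κ →L[ℂ] Hilb μ} (hA : ‖A‖ ≤ 1)
    (B : Hilb ι →L[ℂ] Hilb κ) : hilbertSchmidt (A ∘L B) ≤ hilbertSchmidt B := by
  refine ENNReal.tsum_le_tsum fun i => ENNReal.ofReal_le_ofReal ?_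
  exact pow_le_pow_left₀ (norm_nonneg _) (A.le_of_opNorm_le hA _ |>.trans_eq (one_mul _)) 2

theorem hilbertSchmidt_le_of_forall_finset {ι κ : Type} {A : Hilb ι →L[ℂ] Hilb κ} {β : ℝ}
    (h : ∀ F : Finset ι, ∑ i ∈ F, ‖A (ket i)‖ ^ 2 ≤ β) : hilbertSchmidt A ≤ ENNReal.ofReal β := by
  rw [hilbertSchmidt, ENNReal.tsum_eq_iSup_sum]
  refine iSup_le fun F => ?_
  rw [← ENNReal.ofReal_sum_of_nonneg fun _ _ => by positivity]
  exact ENNReal.ofReal_le_ofReal (h F)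

theorem sum_le_of_hilbertSchmidt_le {ι κ : Type} {A : Hilb ι →L[ℂ] Hilb κ} {β : ℝ} (hβ : 0 ≤ β)
    (h : hilbertSchmidt A ≤ ENNReal.ofReal β) (F : Finset ι) :
    ∑ i ∈ F, ‖A (ket i)‖ ^ 2 ≤ β := by
  rw [← ENNReal.ofReal_le_ofReal_iff hβ, ENNReal.ofReal_sum_of_nonneg fun _ _ => by positivity]
  exact (ENNReal.sum_le_tsum F).trans h

theorem norm_opSqrt_sq {H : Type} [NormedAddCommGroup H] [InnerProductSpace ℂ H]
    [CompleteSpace H] {A : H →L[ℂ] H} (hA : A.IsPositive) (x : H) :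
    ‖opSqrt A x‖ ^ 2 = (inner ℂ x (A x) : ℂ).re := by
  rw [← inner_opSqrt_opSqrt hA, inner_self_eq_norm_sq_to_K]
  norm_cast

/-! ### The trace of the modulus of an operator -/

/-- An approximate polar decomposition: if `B = |X|`, then `B` is close to `X* Y` for
a contraction `Y`. -/
theorem exists_contraction {H E : Type} [NormedAddCommGroup H] [InnerProductSpace ℂ H]
    [CompleteSpace H] [NormedAddCommGroup E] [InnerProductSpace ℂ E] [CompleteSpace E]
    {B : H →L[ℂ] H} (hB : B.IsPositive) {X : H →L[ℂ] E}
    (hX : ∀ x y, inner ℂ (X x) (X y) = (inner ℂ (B x) (B y) : ℂ)) {δ : ℝ} (hδ : 0 < δ) :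
    ∃ Y : H →L[ℂ] E, ‖Y‖ ≤ 1 ∧ ∀ x, ‖x‖ = 1 →
      (inner ℂ x (B x) : ℂ).re ≤ (inner ℂ (X x) (Y x) : ℂ).re + δ := by
  have hB0 : 0 ≤ B := (ContinuousLinearMap.nonneg_iff_isPositive _).2 hB
  -- `C = B + δ` is invertible even when `B` is not. With `D = C⁻¹`, the operator `Y = X D` stands
  -- in for the polar isometry, and `‖X x‖ = ‖B x‖ ≤ ‖C x‖` makes it a contraction.
  let C : H →L[ℂ] H := B + (δ : ℂ) • 1
  have hC : ∀ x, C x = B x + (δ : ℂ) • x := fun x => rfl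
  have hu : IsUnit C := by
    refine CStarAlgebra.isUnit_of_le ((δ : ℂ) • (1 : H →L[ℂ] H)) ?_ ?_
    · exact le_add_of_nonneg_left hB0
    · rw [← Algebra.algebraMap_eq_smul_one]
      refine ((isUnit_iff_ne_zero.2 ?_).map (algebraMap ℂ (H →L[ℂ] H))).isStrictlyPositive ?_
      · exact_mod_cast hδ.ne'
      · rw [Algebra.algebraMap_eq_smul_one]
        exact smul_nonneg (by exact_mod_cast hδ.le) zero_le_one
  obtain ⟨⟨_, D, hCD, hDC⟩, rfl⟩ := hu
  have hCD' (x) : C (D x) = x := congrArg (fun A : H →L[ℂ] H => A x) hCD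
  have hDC' (x) : D (C x) = x := congrArg (fun A : H →L[ℂ] H => A x) hDC
  have hnorm (x) : ‖B x‖ ≤ ‖C x‖ := by
    have h1 : ‖C x‖ ^ 2 = ‖B x‖ ^ 2 + 2 * (δ * (inner ℂ (B x) x : ℂ).re) + ‖(δ : ℂ) • x‖ ^ 2 := by
      rw [hC, norm_add_sq (𝕜 := ℂ), inner_smul_right]
      simp
    have h2 : 0 ≤ (inner ℂ (B x) x : ℂ).re := hB.re_inner_nonneg_left x
    refine le_of_sq_le_sq ?_ (norm_nonneg _)
    nlinarith [mul_nonneg hδ.le h2, sq_nonneg ‖(δ : ℂ) • x‖]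
  have hnX (x) : ‖X x‖ = ‖B x‖ := by
    have h1 := hX x x
    rw [inner_self_eq_norm_sq_to_K, inner_self_eq_norm_sq_to_K] at h1
    exact (sq_eq_sq₀ (norm_nonneg _) (norm_nonneg _)).1 (by exact_mod_cast h1)
  have hBD (x) : ‖B (D x)‖ ≤ ‖x‖ := by
    simpa [hCD'] using hnorm (D x)
  have hcomm (x) : B (D x) = D (B x) := by
    have h1 : B (D x) = x - (δ : ℂ) • D x := by
      have := hC (D x)
      rw [hCD'] at this
      rw [eq_sub_iff_add_eq]
      exact this.symm
    have h2 : D (B x) = x - (δ : ℂ) • D x := by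
      have := congrArg D (hC x)
      rw [hDC', map_add, map_smul] at this
      rw [eq_sub_iff_add_eq]
      exact this.symm
    rw [h1, h2]
  refine ⟨X ∘L D, ContinuousLinearMap.opNorm_le_bound _ zero_le_one fun x => ?_, fun x hx => ?_⟩
  · rw [one_mul, ContinuousLinearMap.comp_apply, hnX]
    exact hBD x
  · have h1 : B x = B (B (D x)) + (δ : ℂ) • B (D x) := by
      rw [← hC, hcomm, hCD']
    have h2 : (inner ℂ x (B x) : ℂ) = inner ℂ (X x) ((X ∘L D) x) + δ * inner ℂ x (B (D x)) := by
      have h3 : inner ℂ (B x) (B (D x)) = (inner ℂ x (B (B (D x))) : ℂ) := hB.isSymmetric x _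
      rw [ContinuousLinearMap.comp_apply, hX, h3, ← inner_smul_right, ← inner_add_right]
      exact congrArg _ h1
    have h3 : (inner ℂ x (B (D x)) : ℂ).re ≤ 1 := by
      refine (Complex.re_le_norm _).trans ((norm_inner_le_norm _ _).trans ?_)
      have := hBD x
      rw [hx] at this ⊢
      linarith
    rw [h2, Complex.add_re, Complex.re_ofReal_mul]
    nlinarith

/-- Hölder's inequality for the trace of the modulus `B = |r A|`. -/
theorem sum_inner_le {ι κ : Type} {B : Hilb ι →L[ℂ] Hilb ι} (hB : B.IsPositive)
    {A : Hilb ι →L[ℂ] Hilb κ} {r : Hilb κ →L[ℂ] Hilb κ} (hr : r.adjoint = r)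
    (hX : ∀ x y, inner ℂ ((r ∘L A) x) ((r ∘L A) y) = (inner ℂ (B x) (B y) : ℂ)) {β : ℝ}
    (hβ : 0 ≤ β) (hA : hilbertSchmidt A ≤ ENNReal.ofReal β)
    (hr1 : hilbertSchmidt r ≤ ENNReal.ofReal 1) (F : Finset ι) :
    ∑ i ∈ F, (inner ℂ (ket i) (B (ket i)) : ℂ).re ≤ √β := by
  refine le_of_forall_pos_le_add fun η hη => ?_
  -- The approximation error `δ` is incurred once for each index in `F`.
  obtain ⟨δ, hδ, hδη⟩ : ∃ δ : ℝ, 0 < δ ∧ F.card * δ ≤ η := by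
    refine ⟨η / (F.card + 1), by positivity, ?_⟩
    rw [← mul_div_assoc, div_le_iff₀ (by positivity)]
    nlinarith
  obtain ⟨Y, hY, hBY⟩ := exists_contraction hB hX hδ
  -- Taking adjoints puts the contraction on the left, where it does not increase the
  -- Hilbert–Schmidt norm.
  have hrY : hilbertSchmidt (r ∘L Y) ≤ ENNReal.ofReal 1 := by
    rw [← hilbertSchmidt_adjoint, ContinuousLinearMap.adjoint_comp, hr]
    refine (hilbertSchmidt_comp_le ?_ r).trans hr1
    rwa [LinearIsometryEquiv.norm_map]
  have h1 (i : ι) : (inner ℂ (ket i) (B (ket i)) : ℂ).re ≤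
      ‖A (ket i)‖ * ‖(r ∘L Y) (ket i)‖ + δ := by
    refine (hBY (ket i) (norm_ket i)).trans (add_le_add_left ?_ δ)
    refine (Complex.re_le_norm _).trans ?_
    rw [ContinuousLinearMap.comp_apply, ← ContinuousLinearMap.adjoint_inner_right, hr]
    exact norm_inner_le_norm _ _
  have h2 : ∑ i ∈ F, ‖A (ket i)‖ * ‖(r ∘L Y) (ket i)‖ ≤ √β * √1 :=
    (Real.sum_mul_le_sqrt_mul_sqrt _ _ _).trans (mul_le_mul
      (Real.sqrt_le_sqrt (sum_le_of_hilbertSchmidt_le hβ hA F))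
      (Real.sqrt_le_sqrt (sum_le_of_hilbertSchmidt_le zero_le_one hrY F))
      (Real.sqrt_nonneg _) (Real.sqrt_nonneg _))
  have h3 := Finset.sum_le_sum fun i (_ : i ∈ F) => h1 i
  rw [Finset.sum_add_distrib, Finset.sum_const, nsmul_eq_mul] at h3
  rw [Real.sqrt_one, mul_one] at h2
  linarith

/-- A bound for the fidelity with a state of the form `T* ω₀ T`. -/
theorem fidelity_le {ι κ : Type} {T : Hilb ι →L[ℂ] Hilb κ} {ω₀ : TraceClass κ}
    (hω₀ : IsState ω₀) {γ ω : TraceClass ι} (hω : ω.1.PosSemidef)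
    (hγ : ∀ x y, inner ℂ x (TraceClass.op γ y) = (inner ℂ (T x) (TraceClass.op ω₀ (T y)) : ℂ))
    {β : ℝ} (hβ : 0 ≤ β) (h : ∀ F : Finset κ,
      ∑ k ∈ F, (inner ℂ (T.adjoint (ket k)) (TraceClass.op ω (T.adjoint (ket k))) : ℂ).re ≤ β) :
    fidelity γ ω ≤ β := by
  set s := opSqrt (TraceClass.op ω) with hs
  set r := opSqrt (TraceClass.op ω₀) with hr
  have hω' := op_isPositive hω
  have hω₀' := op_isPositive hω₀.1
  have hsa : s.adjoint = s := (opSqrt_isPositive _).isSelfAdjoint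
  have hra : r.adjoint = r := (opSqrt_isPositive _).isSelfAdjoint
  -- With `s = √ω` and `r = √ω₀`, `X* X = s γ s`, so the fidelity is `(Tr |X|)²`. Hölder's
  -- inequality bounds it by `‖r‖₂² ‖T s‖₂²`, where `‖r‖₂² = Tr ω₀ = 1` and `‖T s‖₂² = Tr T ω T*`.
  let X : Hilb ι →L[ℂ] Hilb κ := r ∘L T ∘L s
  have hXG (x y) : inner ℂ (X x) (X y) = (inner ℂ x ((s * TraceClass.op γ * s) y) : ℂ) := by
    change inner ℂ (r (T (s x))) (r (T (s y))) = inner ℂ x (s (TraceClass.op γ (s y)))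
    rw [hr, inner_opSqrt_opSqrt hω₀', ← hγ, hs, inner_opSqrt]
  have hG : (s * TraceClass.op γ * s).IsPositive := by
    have h1 : s * TraceClass.op γ * s = X.adjoint ∘L X := by
      refine ContinuousLinearMap.ext fun y => ext_inner_left ℂ fun x => ?_
      rw [ContinuousLinearMap.comp_apply, ContinuousLinearMap.adjoint_inner_right, hXG]
    rw [h1]
    exact ContinuousLinearMap.isPositive_adjoint_comp_self X
  have hT : hilbertSchmidt (T ∘L s) ≤ ENNReal.ofReal β := by
    rw [← hilbertSchmidt_adjoint, ContinuousLinearMap.adjoint_comp, hsa]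
    refine hilbertSchmidt_le_of_forall_finset fun F => ?_
    simpa only [ContinuousLinearMap.comp_apply, hs, norm_opSqrt_sq hω'] using h F
  have hr1 : hilbertSchmidt r ≤ ENNReal.ofReal 1 := by
    refine hilbertSchmidt_le_of_forall_finset fun F => ?_
    have h1 := sum_le_hasSum F (fun i _ => hω₀.1.re_diag_nonneg i) (TraceClass.hasSum_diag ω₀)
    rw [hω₀.2, Complex.one_re] at h1
    refine le_of_eq_of_le (Finset.sum_congr rfl fun i _ => ?_) h1
    rw [hr, norm_opSqrt_sq hω₀', ← entry_op, entry]
  set B := opSqrt (s * TraceClass.op γ * s) with hBdef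
  have hB : B.IsPositive := opSqrt_isPositive _
  have hsum (F : Finset ι) : ∑ i ∈ F, (entry B i i).re ≤ √β :=
    sum_inner_le hB (A := T ∘L s) hra
      (fun x y => by rw [hBdef, inner_opSqrt_opSqrt hG]; exact hXG x y) hβ hT hr1 F
  have hnn (i) : 0 ≤ (entry B i i).re := hB.re_inner_nonneg_right (ket i)
  have htsum : ∑' i, (entry B i i).re ≤ √β := Real.tsum_le_of_sum_le hnn hsum
  calc fidelity γ ω = (∑' i, (entry B i i).re) ^ 2 := rfl
    _ ≤ √β ^ 2 := pow_le_pow_left₀ (tsum_nonneg hnn) htsum 2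
    _ = β := Real.sq_sqrt hβ

theorem memℓp_two_of_summable {ι : Type} {v : ι → ℂ} (h : Summable fun i => ‖v i‖ ^ 2) :
    Memℓp v 2 := by
  rw [memℓp_gen_iff (by norm_num)]
  simpa using h

/-! ### Fully separable states as operators -/

/-- The quadratic form of `∑ⱼ wⱼ |vⱼ⟩⟨vⱼ|`. -/
theorem hasSum_inner_op {ι J : Type} {w : J → ℝ} (hw : ∀ j, 0 ≤ w j) (hw1 : Summable w)
    {v : J → Hilb ι} (hv : ∀ j, ‖v j‖ ≤ 1) {T : TraceClass ι}
    (h : ∀ x y, HasSum (fun j => (w j : ℂ) * (v j x * star (v j y))) (T.1 x y)) (z : Hilb ι) :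
    HasSum (fun j => w j * ‖(inner ℂ z (v j) : ℂ)‖ ^ 2)
      (inner ℂ z (TraceClass.op T z) : ℂ).re := by
  let R (j) : Hilb ι →L[ℂ] Hilb ι := (w j : ℂ) • InnerProductSpace.rankOne ℂ (v j) (v j)
  have hR (j y) : R j y = (w j : ℂ) • (inner ℂ (v j) y : ℂ) • v j := rfl
  -- The rank-one series converges in operator norm, dominated by the weights; its sum is then
  -- identified with `T` by entries.
  have hs : Summable R := by
    refine Summable.of_norm_bounded hw1 fun j => ?_
    rw [norm_smul, Complex.norm_real, Real.norm_of_nonneg (hw j),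
      InnerProductSpace.norm_rankOne]
    refine mul_le_of_le_one_right (hw j) ?_
    exact mul_le_one₀ (hv j) (norm_nonneg _) (hv j)
  have happ (x y : Hilb ι) : HasSum (fun j => inner ℂ x (R j y)) (inner ℂ x ((∑' j, R j) y)) :=
    (hs.hasSum.mapL (ContinuousLinearMap.apply ℂ (Hilb ι) y)).mapL (innerSL ℂ x)
  have hop : ∑' j, R j = TraceClass.op T := by
    refine op_ext fun i k => ?_
    rw [entry_op]
    refine HasSum.unique (happ (ket i) (ket k)) ((h i k).congr_fun fun j => ?_)
    rw [hR, inner_smul_right, inner_smul_right, inner_ket_left, inner_ket_right]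
    ring
  rw [← hop]
  refine (Complex.hasSum_re (happ z z)).congr_fun fun j => ?_
  rw [hR, inner_smul_right, inner_smul_right, Complex.re_ofReal_mul, ← inner_conj_symm,
    Complex.mul_conj, Complex.normSq_eq_norm_sq, Complex.ofReal_re, Complex.norm_conj]

/-- The product vector `⨂ₚ ψₚ`. -/
noncomputable def productVector {P : Type} [Fintype P] {X : P → Type} (ψ : ∀ p, X p → ℂ)
    (hψ : ∀ p, Summable fun x => ‖ψ p x‖ ^ 2) : Hilb (∀ p, X p) :=
  ⟨fun x => ∏ p, ψ p (x p), memℓp_two_of_summable (by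
    simpa [Finset.prod_pow] using (hasSum_pi_prod_real (f := fun p x => ‖ψ p x‖ ^ 2)
      (fun _ _ => by positivity) fun p => (hψ p).hasSum).summable)⟩

theorem norm_productVector_sq {P : Type} [Fintype P] {X : P → Type} {ψ : ∀ p, X p → ℂ}
    {a : P → ℝ} (hψ : ∀ p, HasSum (fun x => ‖ψ p x‖ ^ 2) (a p)) :
    ‖productVector ψ fun p => (hψ p).summable‖ ^ 2 = ∏ p, a p := by
  refine (hasSum_norm_sq _).unique ?_
  simpa [productVector, Finset.prod_pow] using
    hasSum_pi_prod_real (f := fun p x => ‖ψ p x‖ ^ 2) (fun _ _ => by positivity) hψ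

/-- A bound on `Tr T σ T*` for fully separable states `σ`, from the bound for product vectors. -/
theorem IsFullySeparable.sum_inner_le {P κ : Type} [Fintype P] {X : P → Type}
    {σ : TraceClass (∀ p, X p)} (hσ : IsFullySeparable σ) {T : Hilb (∀ p, X p) →L[ℂ] Hilb κ}
    {b : ℝ} (hT : ∀ (ψ : ∀ p, X p → ℂ) (hψ : ∀ p, HasSum (fun x => ‖ψ p x‖ ^ 2) 1),
      ‖T (productVector ψ fun p => (hψ p).summable)‖ ^ 2 ≤ b) (F : Finset κ) :
    ∑ k ∈ F, (inner ℂ (T.adjoint (ket k)) (TraceClass.op σ (T.adjoint (ket k))) : ℂ).re ≤ b := by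
  obtain ⟨J, _, w, ψ, hw, hw1, hψ, h⟩ := hσ
  let v (j) := productVector (ψ j) fun p => (hψ j p).summable
  have hv (j) : ‖v j‖ ≤ 1 := by
    refine le_of_sq_le_sq ?_ zero_le_one
    rw [norm_productVector_sq (hψ j), Finset.prod_const_one, one_pow]
  have h1 := hasSum_sum fun k (_ : k ∈ F) => hasSum_inner_op hw hw1.summable hv
    (T := σ) (fun x y => (h x y).congr_fun fun j => by
      simp [v, productVector, Finset.prod_mul_distrib]) (T.adjoint (ket k))
  have h2 := hw1.mul_right b
  rw [one_mul] at h2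
  refine hasSum_le (fun j => ?_) h1 h2
  rw [← Finset.mul_sum]
  refine mul_le_mul_of_nonneg_left (le_trans ?_ (hT (ψ j) (hψ j))) (hw j)
  -- The sum over `F` becomes a partial sum of `‖T v‖²` in coordinates.
  simp only [ContinuousLinearMap.adjoint_inner_left, inner_ket_left]
  exact sum_le_hasSum F (fun _ _ => by positivity) (hasSum_norm_sq (T (v j)))

/-! ### Private states -/

/-- The restriction of functions along an injective map. -/
noncomputable def restrictHilb {ι κ : Type} {f : κ → ι} (hf : f.Injective) :
    Hilb ι →L[ℂ] Hilb κ :=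
  LinearMap.mkContinuous
    { toFun := fun x => ⟨fun k => x (f k),
        memℓp_two_of_summable ((hasSum_norm_sq x).summable.comp_injective hf)⟩
      map_add' := fun _ _ => rfl
      map_smul' := fun _ _ => rfl } 1 fun x => by
    rw [one_mul]
    refine le_of_sq_le_sq ?_ (norm_nonneg _)
    refine le_of_eq_of_le (hasSum_norm_sq _).tsum_eq.symm ?_
    rw [← (hasSum_norm_sq x).tsum_eq]
    exact tsum_comp_le_tsum_of_inj (hasSum_norm_sq x).summable (fun _ => by positivity) hf

theorem restrictHilb_apply {ι κ : Type} {f : κ → ι} (hf : f.Injective) (x : Hilb ι) (k : κ) :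
    restrictHilb hf x k = x (f k) := rfl

theorem norm_star_unitary_apply {H : Type} [NormedAddCommGroup H] [InnerProductSpace ℂ H]
    [CompleteSpace H] (V : unitary (H →L[ℂ] H)) (x : H) : ‖(star V.1) x‖ = ‖x‖ := by
  have h : inner ℂ ((star V.1) x) ((star V.1) x) = (inner ℂ x x : ℂ) := by
    rw [ContinuousLinearMap.star_eq_adjoint, ContinuousLinearMap.adjoint_inner_left,
      ← ContinuousLinearMap.star_eq_adjoint]
    exact congrArg (fun A : H →L[ℂ] H => (inner ℂ x (A x) : ℂ)) (Unitary.mul_star_self_of_mem V.2)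
  rw [inner_self_eq_norm_sq_to_K, inner_self_eq_norm_sq_to_K] at h
  exact (sq_eq_sq₀ (norm_nonneg _) (norm_nonneg _)).1 (by exact_mod_cast h)

section PrivateState

variable {P : Type} {K : ℕ} {S : P → Type}

theorem keyEmbedding_injective (c : Fin K) :
    Function.Injective fun (s : ∀ p, S p) (p : P) => (c, s p) :=
  fun _ _ h => funext fun p => congrArg Prod.snd (congrFun h p)

/-- The untwisting `(⟨GHZ| ⊗ 1) U*` of a private state with twisting unitaries `V`. -/
noncomputable def untwist (V : (P → Fin K) → unitary (Hilb (∀ p, S p) →L[ℂ] Hilb (∀ p, S p))) :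
    Hilb (∀ p, Fin K × S p) →L[ℂ] Hilb (∀ p, S p) :=
  (((√K)⁻¹ : ℝ) : ℂ) • ∑ c : Fin K,
    (star (V fun _ => c).1) ∘L restrictHilb (keyEmbedding_injective c)

theorem ket_apply {ι : Type} [DecidableEq ι] (i j : ι) :
    (ket i : Hilb ι) j = if i = j then 1 else 0 := by
  have h : (ket i : Hilb ι) = lp.single 2 i 1 := by
    unfold ket
    congr!
  rw [h, lp.single_apply, Pi.single_apply]
  simp only [eq_comm]

/-- Only constant key tuples survive, matching the support of `ghz`. A party must exist for the
constant value to be unique. -/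
theorem untwist_ket [Nonempty P]
    (V : (P → Fin K) → unitary (Hilb (∀ p, S p) →L[ℂ] Hilb (∀ p, S p)))
    (x : ∀ p, Fin K × S p) : untwist V (ket x) =
      ghz K (fun p => (x p).1) • (star (V fun p => (x p).1).1) (ket fun p => (x p).2) := by
  classical
  have hr (c : Fin K) : restrictHilb (keyEmbedding_injective c) (ket x) =
      if (∀ p, (x p).1 = c) then (ket fun p => (x p).2 : Hilb (∀ p, S p)) else 0 := by
    ext s
    rw [restrictHilb_apply, ket_apply]
    have h : (x = fun p => (c, s p)) ↔ (∀ p, (x p).1 = c) ∧ (fun p => (x p).2) = s := by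
      simp only [funext_iff, Prod.ext_iff, forall_and]
    split_ifs with h1 h2 h2
    · rw [ket_apply, if_pos (h.1 h1).2]
    · exact absurd (h.1 h1).1 h2
    · rw [ket_apply, if_neg fun h3 => h1 (h.2 ⟨h2, h3⟩)]
    · rfl
  simp only [untwist, _root_.smul_apply, _root_.sum_apply,
    ContinuousLinearMap.comp_apply, hr, ghz]
  split_ifs with h
  · obtain ⟨c, hc⟩ := h
    rw [Finset.sum_eq_single c, if_pos hc]
    · congr 5
      exact funext fun p => (hc p).symm
    · intro c' _ hc'
      rw [if_neg, map_zero]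
      exact fun h => hc' ((h (Classical.arbitrary P)).symm.trans (hc _))
    · simp
  · rw [zero_smul, Finset.sum_eq_zero, smul_zero]
    intro c _
    rw [if_neg fun h' => h ⟨c, h'⟩, map_zero]

/-- This puts the private state in the form `T* ω T` required by `QInfo.fidelity_le`, with `T =
untwist V`. -/
theorem inner_op_privateState [Nonempty P] {γ : TraceClass (∀ p, Fin K × S p)}
    {ω : TraceClass (∀ p, S p)}
    {V : (P → Fin K) → unitary (Hilb (∀ p, S p) →L[ℂ] Hilb (∀ p, S p))}
    (h : ∀ x y : ∀ p, Fin K × S p,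
      γ.1 x y = ghz K (fun p => (x p).1) * star (ghz K (fun p => (y p).1)) *
        entry ((V fun p => (x p).1).1 * TraceClass.op ω * star (V fun p => (y p).1).1)
          (fun p => (x p).2) (fun p => (y p).2)) (x y) :
    inner ℂ x (TraceClass.op γ y) =
      (inner ℂ (untwist V x) (TraceClass.op ω (untwist V y)) : ℂ) := by
  have hg (k : P → Fin K) : star (ghz K k) = ghz K k := by
    unfold ghz
    split_ifs <;> simp
  have hop : TraceClass.op γ = (untwist V).adjoint ∘L TraceClass.op ω ∘L untwist V := by
    refine op_ext fun i j => ?_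
    rw [entry_op, h, entry, entry, ContinuousLinearMap.comp_apply,
      ContinuousLinearMap.adjoint_inner_right, ContinuousLinearMap.comp_apply, untwist_ket,
      untwist_ket, map_smul, inner_smul_left, inner_smul_right,
      ContinuousLinearMap.star_eq_adjoint (V fun p => (i p).1).1,
      ContinuousLinearMap.adjoint_inner_left, ← Complex.star_def, hg, hg, mul_assoc]
    rfl
  rw [hop, ContinuousLinearMap.comp_apply, ContinuousLinearMap.adjoint_inner_right]
  rfl

/-- The privacy test is passed by product vectors with probability at most `1 / K`. -/
theorem norm_untwist_productVector_sq_le [Fintype P] [Nontrivial P]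
    (V : (P → Fin K) → unitary (Hilb (∀ p, S p) →L[ℂ] Hilb (∀ p, S p)))
    {ψ : ∀ p, Fin K × S p → ℂ} (hψ : ∀ p, HasSum (fun x => ‖ψ p x‖ ^ 2) 1) :
    ‖untwist V (productVector ψ fun p => (hψ p).summable)‖ ^ 2 ≤ (K : ℝ)⁻¹ := by
  classical
  have hs (p c) : Summable fun s => ‖ψ p (c, s)‖ ^ 2 :=
    (hψ p).summable.comp_injective (Prod.mk_right_injective c)
  -- The probability that party `p` finds the key value `c`.
  let a (p : P) (c : Fin K) : ℝ := ∑' s, ‖ψ p (c, s)‖ ^ 2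
  have ha (p c) : HasSum (fun s => ‖ψ p (c, s)‖ ^ 2) (a p c) := (hs p c).hasSum
  have ha0 (p c) : 0 ≤ a p c := tsum_nonneg fun _ => by positivity
  have ha1 (p) : ∑ c, a p c = 1 :=
    (hasSum_fintype _).unique ((hψ p).prod_fiberwise (ha p))
  have hle (p c) : a p c ≤ 1 :=
    (Finset.single_le_sum (fun c _ => ha0 p c) (Finset.mem_univ c)).trans_eq (ha1 p)
  -- Two parties suffice: the factors of all others are at most `1`.
  obtain ⟨p, q, hpq⟩ := exists_pair_ne P
  have hn (c : Fin K) : ‖restrictHilb (keyEmbedding_injective c)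
      (productVector ψ fun p => (hψ p).summable)‖ ≤ √(a p c) * √(a q c) := by
    rw [← Real.sqrt_mul (ha0 p c)]
    refine Real.le_sqrt_of_sq_le ?_
    have h1 : ‖restrictHilb (keyEmbedding_injective c)
        (productVector ψ fun p => (hψ p).summable)‖ ^ 2 = ∏ p, a p c :=
      norm_productVector_sq (ψ := fun p s => ψ p (c, s)) fun p => ha p c
    rw [h1, ← Finset.prod_pair (f := fun p => a p c) hpq]
    exact Finset.prod_le_prod_of_subset_of_le_one (Finset.subset_univ _) (fun p _ => ha0 p c)
      fun p _ _ => hle p c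
  -- Cauchy–Schwarz for the key distributions of `p` and `q`; the remaining `K^(-1/2)` comes from
  -- the GHZ amplitude.
  have hsum : ∑ c, √(a p c) * √(a q c) ≤ 1 := by
    refine (Real.sum_sqrt_mul_sqrt_le _ (ha0 p) (ha0 q)).trans ?_
    rw [ha1, ha1]
    simp
  have hnorm : ‖untwist V (productVector ψ fun p => (hψ p).summable)‖ ≤ (√K)⁻¹ := by
    rw [untwist, _root_.smul_apply, norm_smul, Complex.norm_real,
      Real.norm_of_nonneg (by positivity), _root_.sum_apply]
    refine mul_le_of_le_one_right (by positivity) ((norm_sum_le _ _).trans ?_)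
    refine (Finset.sum_le_sum fun c _ => ?_).trans hsum
    rw [ContinuousLinearMap.comp_apply, norm_star_unitary_apply]
    exact hn c
  calc _ ≤ (√K)⁻¹ ^ 2 := pow_le_pow_left₀ (norm_nonneg _) hnorm 2
    _ = (K : ℝ)⁻¹ := by rw [inv_pow, Real.sq_sqrt (Nat.cast_nonneg K)]

/-- The fidelity of a private state with a state below `M` times a fully separable state is at most
`M / K`. -/
theorem IsPrivateState.fidelity_le [Fintype P] [Nontrivial P]
    {γ ω σ : TraceClass (∀ p, Fin K × S p)} (hγ : IsPrivateState γ) (hω : ω.1.PosSemidef)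
    (hσ : IsFullySeparable σ) {M : ℝ} (hM : 0 ≤ M)
    (h : ((M : ℂ) • σ.1 - ω.1).PosSemidef) : fidelity γ ω ≤ M * (K : ℝ)⁻¹ := by
  obtain ⟨ω₀, V, hω₀, hV⟩ := hγ
  refine QInfo.fidelity_le hω₀ hω (inner_op_privateState hV) (by positivity) fun F => ?_
  have h1 := hσ.sum_inner_le (T := untwist V)
    (fun ψ hψ => norm_untwist_productVector_sq_le V hψ) F
  refine le_trans ?_ (mul_le_mul_of_nonneg_left h1 hM)
  rw [Finset.mul_sum]
  refine Finset.sum_le_sum fun k _ => ?_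
  have hop : TraceClass.op ((M : ℂ) • σ - ω) = (M : ℂ) • TraceClass.op σ - TraceClass.op ω := by
    refine op_ext fun i j => ?_
    rw [entry_op, entry, _root_.sub_apply, _root_.smul_apply,
      inner_sub_right, inner_smul_right, ← entry, ← entry, entry_op, entry_op]
    rfl
  have h2 := (op_isPositive (T := (M : ℂ) • σ - ω) h).re_inner_nonneg_right
    ((untwist V).adjoint (ket k))
  rw [hop, _root_.sub_apply, _root_.smul_apply, inner_sub_right,
    inner_smul_right] at h2
  change 0 ≤ (_ - _ : ℂ).re at h2
  rw [Complex.sub_re, Complex.re_ofReal_mul] at h2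
  linarith

end PrivateState

/-! ### The bound on the size of the key -/

section Protocol

variable {𝒜 ℬ 𝒞 : Type} [Fintype 𝒜] [Fintype ℬ] [Fintype 𝒞]
  {A' A : 𝒜 → Type} {B : ℬ → Type} {C : 𝒞 → Type}

theorem posSemidef_smul_sub_map {ι κ : Type} {Φ : TraceClass ι →ₗ[ℂ] TraceClass κ}
    (hΦ : ∀ T : TraceClass ι, T.1.PosSemidef → (Φ T).1.PosSemidef) {ρ σ : TraceClass ι} {c : ℝ}
    (h : ((c : ℂ) • σ.1 - ρ.1).PosSemidef) : ((c : ℂ) • (Φ σ).1 - (Φ ρ).1).PosSemidef := by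
  have := hΦ ((c : ℂ) • σ - ρ) h
  rwa [map_sub, map_smul] at this

/-- One use of the channel increases the max-relative entropy of entanglement at most by
that of the channel. -/
theorem exists_isFullySeparable_amortized (N : MultiplexChannel A' A B C)
    {Q : 𝒜 ⊕ ℬ ⊕ 𝒞 → Type} [∀ p, Countable (Q p)] {l : ℝ} (hl : channelMaxEntanglementPure N < l)
    {ρ σ : TraceClass (∀ p, Q p × InSys 𝒞 A' B p)} (hσ : IsFullySeparable σ) {c : ℝ} (hc : 0 ≤ c)
    (h : ((c : ℂ) • σ.1 - ρ.1).PosSemidef) :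
    ∃ τ, IsFullySeparable τ ∧
      (((c * (2 : ℝ) ^ l : ℝ) : ℂ) • τ.1 - (N.onSharesLin Q ρ).1).PosSemidef := by
  obtain ⟨τ, hτ, hστ⟩ := exists_isFullySeparable_onShares N hl hσ
  refine ⟨τ, hτ, ?_⟩
  -- The difference splits as `c (2 ^ l τ - N(σ)) + N(c σ - ρ)`.
  convert (posSemidef_ofReal_smul hστ hc).add
    (posSemidef_smul_sub_map (fun _ => N.posSemidef_onShares Q) h) using 1
  ext x y
  simp
  ring

/-- The input of use number `n` has passed through `m = n - 1` uses, whence the exponent `m`; the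
initial state is its own dominating state. -/
theorem IsProtocolInput.exists_isFullySeparable [∀ a, Countable (A' a)] [∀ b, Countable (B b)]
    {N : MultiplexChannel A' A B C} {l : ℝ} (hl : channelMaxEntanglementPure N < l) {n : ℕ}
    {Q : 𝒜 ⊕ ℬ ⊕ 𝒞 → Type} {ρ : TraceClass (∀ p, Q p × InSys 𝒞 A' B p)}
    (h : IsProtocolInput N n Q ρ) :
    (∀ p, Countable (Q p)) ∧ ρ.1.PosSemidef ∧ ∃ m, n = m + 1 ∧ ∃ σ, IsFullySeparable σ ∧
      (((((2 : ℝ) ^ l) ^ m : ℝ) : ℂ) • σ.1 - ρ.1).PosSemidef := by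
  have hI : ∀ p, Countable (InSys 𝒞 A' B p) := by
    rintro (a | b | c)
    exacts [inferInstanceAs (Countable (A' a)), inferInstanceAs (Countable (B b)),
      inferInstanceAs (Countable Unit)]
  induction h with
  | first Q hQ ρ hρ =>
    refine ⟨hQ, hρ.posSemidef, 0, rfl, ρ, hρ, ?_⟩
    simpa using Matrix.PosSemidef.zero
  | next h Q' hQ' Λ hΛ ih =>
    obtain ⟨hQ, hρ, m, rfl, σ, hσ, hσρ⟩ := ih
    refine ⟨hQ', Λ.posSemidef_map (N.posSemidef_onShares _ hρ), m + 1, rfl, ?_⟩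
    obtain ⟨τ, hτ, hτρ⟩ := exists_isFullySeparable_amortized N hl hσ (by positivity) hσρ
    refine ⟨Λ.toLin τ, hΛ.isFullySeparable hτ, ?_⟩
    rw [pow_succ]
    exact posSemidef_smul_sub_map (fun _ => Λ.posSemidef_map) hτρ

theorem HasProtocol.le_of_lt [∀ a, Countable (A' a)] [∀ b, Countable (B b)]
    (hM : 2 ≤ Fintype.card 𝒜 + Fintype.card ℬ + Fintype.card 𝒞)
    {N : MultiplexChannel A' A B C} {l : ℝ} (hl : channelMaxEntanglementPure N < l) {n K : ℕ}
    {ε : ℝ} (h : HasProtocol N n K ε) : 1 - ε ≤ ((2 : ℝ) ^ l) ^ n * (K : ℝ)⁻¹ := by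
  -- The privacy test needs two distinct parties.
  have hP : Nontrivial (𝒜 ⊕ ℬ ⊕ 𝒞) := by
    rw [← Fintype.one_lt_card_iff_nontrivial]
    simp only [Fintype.card_sum]
    lia
  obtain ⟨Q, ρ, S, D, γ, hin, hS, hD, hγ, hF⟩ := h
  obtain ⟨hQ, hρ, m, rfl, σ, hσ, hσρ⟩ := hin.exists_isFullySeparable hl
  obtain ⟨τ, hτ, hτρ⟩ := exists_isFullySeparable_amortized N hl hσ (by positivity) hσρ
  refine hF.trans (hγ.fidelity_le (D.posSemidef_map (N.posSemidef_onShares Q hρ))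
    (hD.isFullySeparable hτ) (by positivity) ?_)
  rw [pow_succ]
  exact posSemidef_smul_sub_map (fun _ => D.posSemidef_map) hτρ

theorem HasProtocol.logb_le [∀ a, Countable (A' a)] [∀ b, Countable (B b)]
    (hM : 2 ≤ Fintype.card 𝒜 + Fintype.card ℬ + Fintype.card 𝒞)
    {N : MultiplexChannel A' A B C} {l : ℝ} (hl : channelMaxEntanglementPure N < l) {n K : ℕ}
    (hK : 1 ≤ K) {ε : ℝ} (hε : ε < 1) (h : HasProtocol N n K ε) :
    Real.logb 2 K ≤ n * l + Real.logb 2 (1 / (1 - ε)) := by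
  have hK0 : (0 : ℝ) < K := by exact_mod_cast hK
  have hε0 : 0 < 1 - ε := sub_pos.2 hε
  have h1 := h.le_of_lt hM hl
  have h2 : (K : ℝ) ≤ ((2 : ℝ) ^ l) ^ n * (1 / (1 - ε)) := by
    rw [← div_eq_mul_inv, le_div_iff₀ hK0] at h1
    rw [mul_one_div, le_div_iff₀ hε0]
    linarith
  have h3 := Real.logb_le_logb_of_le one_lt_two hK0 h2
  rwa [Real.logb_mul (by positivity) (by positivity), Real.logb_pow,
    Real.logb_rpow two_pos (by norm_num)] at h3

theorem isStrongConverseRate_of_le [∀ a, Countable (A' a)] [∀ b, Countable (B b)]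
    (hM : 2 ≤ Fintype.card 𝒜 + Fintype.card ℬ + Fintype.card 𝒞)
    {N : MultiplexChannel A' A B C} {R : ℝ} (hR : channelMaxEntanglementPure N ≤ R) :
    IsStrongConverseRate N R := by
  intro ε hε0 hε1 δ hδ
  have hlim : Filter.Tendsto (fun n : ℕ => (n : ℝ) * (δ / 2)) Filter.atTop Filter.atTop :=
    tendsto_natCast_atTop_atTop.atTop_mul_const (half_pos hδ)
  filter_upwards [hlim.eventually_gt_atTop (Real.logb 2 (1 / (1 - ε)))] with n hn K hK hp
  have hK0 : (0 : ℝ) < K := lt_of_lt_of_le (by positivity) hK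
  -- Half of `δ` makes the bound on the channel quantity strict; the other half, times `n`, outgrows
  -- the constant `log (1 / (1 - ε))`.
  have hlt : channelMaxEntanglementPure N < ((R + δ / 2 : ℝ) : EReal) :=
    hR.trans_lt (by exact_mod_cast lt_add_of_pos_right R (half_pos hδ))
  have h1 := hp.logb_le hM hlt (by exact_mod_cast hK0) hε1
  have h2 := Real.logb_le_logb_of_le one_lt_two (by positivity) hK
  rw [Real.logb_rpow two_pos (by norm_num)] at h2
  linarith

end Protocol

end QInfo

/-! ### The main theorem -/

theorem mainTheorem3 {𝒜 ℬ 𝒞 : Type} [Fintype 𝒜] [Fintype ℬ] [Fintype 𝒞]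
    (hM : 2 ≤ Fintype.card 𝒜 + Fintype.card ℬ + Fintype.card 𝒞)
    (A' A : 𝒜 → Type) (B : ℬ → Type) (C : 𝒞 → Type)
    [∀ a, Countable (A' a)] [∀ a, Countable (A a)] [∀ b, Countable (B b)] [∀ c, Countable (C c)]
    (N : QInfo.MultiplexChannel A' A B C) :
    (∀ (n K : ℕ) (ε : ℝ), 1 ≤ n → 1 ≤ K → 0 < ε → ε < 1 → QInfo.HasProtocol N n K ε →
      ((1 / (n : ℝ) * Real.logb 2 K : ℝ) : EReal) ≤
        QInfo.channelMaxEntanglement N + ((1 / (n : ℝ) * Real.logb 2 (1 / (1 - ε)) : ℝ) : EReal)) ∧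
    QInfo.channelMaxEntanglement N = QInfo.channelMaxEntanglementPure N ∧
    QInfo.strongConverseCapacity N ≤ QInfo.channelMaxEntanglement N := by
  have heq := QInfo.channelMaxEntanglement_eq_pure N
  refine ⟨fun n K ε hn hK _ hε hp => ?_, heq, ?_⟩
  · have hn0 : (0 : ℝ) < n := by exact_mod_cast hn
    rw [heq]
    -- With the `ε` term moved to the left, a real number is compared with the channel quantity by
    -- testing all real `l` above the latter; infinite values need no separate case.
    have h1 : ((1 / (n : ℝ) * Real.logb 2 K - 1 / (n : ℝ) * Real.logb 2 (1 / (1 - ε)) : ℝ) : EReal)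
        ≤ QInfo.channelMaxEntanglementPure N := by
      refine EReal.le_of_forall_lt_iff_le.1 fun l hl => ?_
      have h2 := hp.logb_le hM hl hK hε
      rw [EReal.coe_le_coe_iff, ← mul_sub, one_div, inv_mul_le_iff₀ hn0]
      linarith
    calc _ = ((1 / (n : ℝ) * Real.logb 2 K - 1 / (n : ℝ) * Real.logb 2 (1 / (1 - ε)) : ℝ) : EReal)
          + ((1 / (n : ℝ) * Real.logb 2 (1 / (1 - ε)) : ℝ) : EReal) := by
            rw [← EReal.coe_add, sub_add_cancel]
      _ ≤ _ := by gcongr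
  · rw [heq]
    refine EReal.le_of_forall_lt_iff_le.1 fun l hl => ?_
    exact iInf₂_le l (QInfo.isStrongConverseRate_of_le hM hl.le)
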